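/- All posets are finite. For $k\ge 3$ let $d_k(1)$ (the double-tailed diamond) be the poset with $2k-2$ elements consisting of a chain of $k-2$ elements, then two incomparable elements above it, then a chain of $k-2$ elements above both. In a poset $P$, an interval $[v,u]$ is a $d_k$-interval if it is isomorphic to $d_k(1)$, and a $d_k^-$-interval is a convex subset isomorphic to $d_k(1)$ with its top element removed. $P$ is $d$-complete if for every $k\ge3$: (D1) for every $d_k^-$-interval $S$ there is an element $u$ covering the maximal elements of $S$ such that $S\cup\{u\}$ is a $d_k$-interval; (D2) if $[v,u]$ is a $d_k$-interval and $u$ covers $x$ in $P$, then $x\in[v,u]$; (D3) no two $d_k^-$-intervals differ only in their minimal elements. The top forest $\Gamma$ of $P$ is the full subgraph of the Hasse diagram on those $x\in P$ such that every $y\ge x$ is covered by at most one element. A $d$-complete coloring is a map $c:P\to I$ that restricts to a bijection $\Gamma\to I$ and satisfies: (C1) incomparable elements have different colors; (C2) if an interval $[v,u]$ is a chain, then the colors of its elements are distinct; (C3) $c(v)=c(u)$ for every $d_k$-interval $[v,u]$. Via $c$, $\Gamma$ is viewed as a simply-laced Dynkin diagram with node set $I$; let $W$ be its Weyl group, i.e.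 the Coxeter group generated by $s_i$ $(i\in I)$ with $s_i^2=1$, $(s_is_j)^3=1$ if $i,j$ are adjacent and $(s_is_j)^2=1$ if $i\ne j$ are not adjacent, and let $l$ be its length function. For $x\in P$ put $s(x)=s_{c(x)}$. Let $*$ be the Demazure (Hecke) product on $W$, the associative product with unit $1$ such that $s_i*w=s_iw$ if $l(s_iw)=l(w)+1$ and $s_i*w=w$ if $l(s_iw)=l(w)-1$. Fix a linear extension $p_1,\dots,p_N$ of $P$ (so $p_i<p_j$ implies $i<j$), and for $D=\{p_{i_1},\dots,p_{i_r}\}\subset P$ with $i_1<\dots<i_r$ put $$w_D=s(p_{i_1})\cdots s(p_{i_r}),\qquad w^*_D=s(p_{i_1})*\cdots*s(p_{i_r}).$$ Let $D\subset P$. For $i\in I$ let $N_i\subset P$ be the set of elements whose color is adjacent to $i$ in $\Gamma$. An element $u\in D$ is $D$-active if there is $v\in P\setminus D$ with $c(v)=c(u)$ and $v<u$ such that $[v,u]$ is a $d_k$-interval for some $k$ and $[v,u]\cap D\cap N_{c(u)}=\emptyset$. In that case, replacing $D$ by $(D\setminus\{u\})\cup\{v\}$ is an ordinary elementary excitation,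 and replacing $D$ by $D\cup\{v\}$ is a $K$-theoretical elementary excitation. A $K$-theoretical excited diagram of an order filter $F$ in $P$ is a subset obtained from $F$ by a (possibly empty) finite sequence of ordinary and $K$-theoretical elementary excitations. Proposition. Let $P$ be a connected $d$-complete poset with $d$-complete coloring $c$, and let $F$ be an order filter of $P$. Then a subset $D\subset P$ is a $K$-theoretical excited diagram of $F$ in $P$ if and only if $w^*_D=w_F$. -/

import Mathlib

/-- Carrier of the double-tailed diamond `d_k(1)` for `k ≥ 3`: inside `ℕ × ℕ` with the product order,
the diagonal points `(a, a)` with `a < 2k - 4`, together with the two incomparable points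
`(k - 2, k - 3)` and `(k - 3, k - 2)`.  So it has `2k - 2` elements: a chain of `k - 2` elements,
then two incomparable elements, then another chain of `k - 2` elements. -/
def doubleTailedDiamond (k : ℕ) : Set (ℕ × ℕ) :=
  {q | (q.1 = q.2 ∧ q.1 < 2 * k - 4) ∨ q = (k - 2, k - 3) ∨ q = (k - 3, k - 2)}

/-- The double-tailed diamond with its top element `(2k - 5, 2k - 5)` removed. -/
def doubleTailedDiamondMinus (k : ℕ) : Set (ℕ × ℕ) :=
  doubleTailedDiamond k \ {(2 * k - 5, 2 * k - 5)}

section Poset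

variable {P : Type*} [PartialOrder P]

/-- `[v, u]` is a `d_k`-interval (`k ≥ 3`). -/
def IsDInterval (k : ℕ) (v u : P) : Prop :=
  3 ≤ k ∧ Nonempty (Set.Icc v u ≃o doubleTailedDiamond k)

/-- `S` is a `d_k⁻`-interval (`k ≥ 3`): a convex subset isomorphic to `d_k(1)` without its top.
For `k ≥ 4` such an `S` has a bottom `v` and a top `u`, and convexity says `S = [v, u]`.
For `k = 3` it is a set `{w, x, y}` where `x ≠ y` both cover `w`. -/
def IsDMinusInterval (k : ℕ) (S : Set P) : Prop :=
  3 ≤ k ∧ S.OrdConnected ∧ Nonempty (S ≃o doubleTailedDiamondMinus k)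

variable (P) in
/-- `d`-complete posets. -/
structure IsDComplete : Prop where
  /-- Every `d_k⁻`-interval `S` is completed to a `d_k`-interval `S ∪ {u}` by some `u` that covers
  the maximal elements of `S`. -/
  exists_top : ∀ (k : ℕ) (S : Set P), IsDMinusInterval k S →
    ∃ v u : P, IsDInterval k v u ∧ Set.Icc v u = insert u S ∧
      ∀ x, Maximal (fun y => y ∈ S) x → x ⋖ u
  /-- The top of a `d_k`-interval covers only elements of that interval. -/
  mem_of_covBy : ∀ (k : ℕ) (v u : P), IsDInterval k v u → ∀ x, x ⋖ u → x ∈ Set.Icc v u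
  /-- No two `d_k⁻`-intervals differ only in their minimal elements. -/
  eq_of_diff_bot : ∀ (k : ℕ) (S S' : Set P), IsDMinusInterval k S → IsDMinusInterval k S' →
    ∀ v v' : P, IsLeast S v → IsLeast S' v' → S \ {v} = S' \ {v'} → S = S'

variable (P) in
/-- The vertex set of the top forest `Γ`: the elements `x` such that every `y ≥ x` is covered by at
most one element. -/
def topForest : Set P :=
  {x | ∀ y, x ≤ y → ∀ z z', y ⋖ z → y ⋖ z' → z = z'}

/-- `c : P → I` is a `d`-complete coloring. -/
structure IsDCompleteColoring {I : Type*} (c : P → I) : Prop where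
  /-- The nodes of the top forest are labelled bijectively by the colors. -/
  bijOn_topForest : Set.BijOn c (topForest P) Set.univ
  /-- Incomparable elements have different colors. -/
  ne_of_incomp : ∀ x y : P, ¬ x ≤ y → ¬ y ≤ x → c x ≠ c y
  /-- The colors in an interval that is a chain are distinct. -/
  injOn_chain : ∀ v u : P, IsChain (· ≤ ·) (Set.Icc v u) → Set.InjOn c (Set.Icc v u)
  /-- The top and the bottom of a `d_k`-interval have the same color. -/
  eq_of_dInterval : ∀ (k : ℕ) (v u : P), IsDInterval k v u → c v = c u

/-- The Dynkin diagram on the set of colors: the top forest (with the edges of the Hasse diagram of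
`P`), its nodes being named by their colors. -/
def dynkinDiagram {I : Type*} (c : P → I) : SimpleGraph I :=
  SimpleGraph.fromRel fun i j => ∃ x ∈ topForest P, ∃ y ∈ topForest P, x ⋖ y ∧ c x = i ∧ c y = j

/-- `N_i`: the elements whose color is adjacent to `i` in the Dynkin diagram. -/
def adjColored {I : Type*} (c : P → I) (i : I) : Set P :=
  {x | (dynkinDiagram c).Adj (c x) i}

/-- `u` is `D`-active, and `v` is the bottom of the `d_k`-interval `[v, u]` witnessing it. -/
def IsActivePair {I : Type*} (c : P → I) (D : Set P) (u v : P) : Prop :=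
  u ∈ D ∧ v ∉ D ∧ c v = c u ∧ v < u ∧ (∃ k, IsDInterval k v u) ∧
    Set.Icc v u ∩ D ∩ adjColored c (c u) = ∅

/-- `D'` is obtained from `D` by an ordinary elementary excitation (replace `u` by `v`) or by a
`K`-theoretical elementary excitation (add `v`). -/
def KExcitation {I : Type*} (c : P → I) (D D' : Set P) : Prop :=
  ∃ u v : P, IsActivePair c D u v ∧ (D' = insert v (D \ {u}) ∨ D' = insert v D)

/-- `D` is a `K`-theoretical excited diagram of `F`. -/
def IsKExcitedDiagram {I : Type*} (c : P → I) (F D : Set P) : Prop :=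
  Relation.ReflTransGen (KExcitation c) F D

open Classical in
/-- The simply-laced Coxeter matrix of a graph: `m_ij = 3` if `i`, `j` are adjacent, and `m_ij = 2`
if `i ≠ j` are not adjacent. -/
noncomputable def simplyLacedCoxeterMatrix {I : Type*} (G : SimpleGraph I) : CoxeterMatrix I where
  M := Matrix.of fun i j => if i = j then 1 else if G.Adj i j then 3 else 2
  isSymm := by
    ext i j
    simp [Matrix.transpose_apply, eq_comm, G.adj_comm]
  diagonal := by simp
  off_diagonal := by
    intro i j h
    simp only [Matrix.of_apply, h, if_false]
    split_ifs <;> norm_num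

open Classical in
/-- `s_i * w` for the Demazure product `*` of a Coxeter group. -/
noncomputable def simpleDemazureMul {I W : Type*} [Group W] {M : CoxeterMatrix I}
    (cs : CoxeterSystem M W) (i : I) (w : W) : W :=
  if cs.length (cs.simple i * w) = cs.length w + 1 then cs.simple i * w else w

/-- The Demazure product `s_{i_1} * ⋯ * s_{i_r}`, computed as `s_{i_1} * (⋯ * (s_{i_r} * 1))`. -/
noncomputable def demazureWordProd {I W : Type*} [Group W] {M : CoxeterMatrix I}
    (cs : CoxeterSystem M W) (ω : List I) : W :=
  ω.foldr (simpleDemazureMul cs) 1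

/-- The labelling `p_1, …, p_N` of `P` is a linear extension: `p_i < p_j` implies `i < j`. -/
def IsLinearExtension {N : ℕ} (p : Fin N ≃ P) : Prop :=
  ∀ i j, p i < p j → i < j

open Classical in
/-- The colors of the elements of `D`, read in the order of the labelling `p`. -/
noncomputable def colorWord {I : Type*} (c : P → I) {N : ℕ} (p : Fin N ≃ P) (D : Set P) : List I :=
  ((List.finRange N).filter fun i => p i ∈ D).map fun i => c (p i)

/-- The Coxeter system of the Weyl group `W` whose Dynkin diagram is the top forest. -/
noncomputable def weylSystem {I : Type*} (c : P → I) :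
    CoxeterSystem (simplyLacedCoxeterMatrix (dynkinDiagram c))
      (simplyLacedCoxeterMatrix (dynkinDiagram c)).Group :=
  (simplyLacedCoxeterMatrix (dynkinDiagram c)).toCoxeterSystem

/-- `w_D = s(p_{i_1}) ⋯ s(p_{i_r})` for `D = {p_{i_1}, …, p_{i_r}}`, `i_1 < ⋯ < i_r`. -/
noncomputable def weylElement {I : Type*} (c : P → I) {N : ℕ} (p : Fin N ≃ P) (D : Set P) :
    (simplyLacedCoxeterMatrix (dynkinDiagram c)).Group :=
  (weylSystem c).wordProd (colorWord c p D)

/-- `w*_D = s(p_{i_1}) * ⋯ * s(p_{i_r})` for `D = {p_{i_1}, …, p_{i_r}}`, `i_1 < ⋯ < i_r`. -/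
noncomputable def weylDemazureElement {I : Type*} (c : P → I) {N : ℕ} (p : Fin N ≃ P)
    (D : Set P) : (simplyLacedCoxeterMatrix (dynkinDiagram c)).Group :=
  demazureWordProd (weylSystem c) (colorWord c p D)

end Poset

/-! ### Relations between simple reflections. -/

section SimplyLaced

variable {I W : Type*} [Group W] {G : SimpleGraph I}
  (cs : CoxeterSystem (simplyLacedCoxeterMatrix G) W)

/-! Let `W` act on the weights λ − ∑ n_j α_j, where λ is the sum of the fundamental weights of the
colors of the maximal elements. When the word of a filter F is applied from its last letter to its
first, each letter meets a weight whose pairing with its coroot is 1, so w_F λ is λ minus the sum of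
the simple roots of the colors of F (`gamePosition_wordProd`). If s_i lengthens w, then w λ pairs
nonnegatively with the coroot of i. Hence every element reaching the weight w_F λ has length at
least |F| (`length_le_of_gamePosition_eq`); so w_F has minimal length modulo the stabilizer of λ,
its word is reduced, and w*_F = w_F.

An excitation preserves w*: elements of adjacent colors are comparable (`le_or_le_of_adj`), so no
letter of D between v and u has a color adjacent to c(u). Thus s(u) can be moved to the place of v,
and s_i * s_i = s_i accounts for keeping both.

Conversely, if w*_D = w_F, undo excitations as long as possible. In what remains, any v ∈ D whose
color recurs at a next element u has an element of D of adjacent color strictly between v and u.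
Reading from the end, the letter at which the filter property breaks meets pairing 0 instead of 1:
it lengthens the product but fixes the weight, and this loss of minimality survives all later
Demazure multiplications (`isUpperSet_or_isExcessive`). As w_F is minimal, D is a filter. The weight
then determines it, since the elements of one color form a chain.

The pairings are computed by counting colors: each v outside the top forest is the bottom of a
d_k-interval [v, u] with exactly two elements of adjacent colors, and none of color c(v), strictly
inside (`exists_isColorSuccessor`). -/

open Classical in
theorem CoxeterSystem.simple_mul_simple_comm_of_not_adj {i j : I} (hij : i ≠ j)
    (h : ¬ G.Adj i j) : cs.simple i * cs.simple j = cs.simple j * cs.simple i := by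
  have h2 := cs.simple_mul_simple_pow i j
  have hM : simplyLacedCoxeterMatrix G i j = 2 := by
    change (if i = j then 1 else if G.Adj i j then 3 else 2) = 2
    simp [hij, h]
  rw [hM, pow_two] at h2
  rw [eq_inv_of_mul_eq_one_left h2, mul_inv_rev, cs.inv_simple, cs.inv_simple]

open Classical in
theorem CoxeterSystem.simple_braid_of_adj {i j : I} (h : G.Adj i j) :
    cs.simple i * cs.simple j * cs.simple i = cs.simple j * cs.simple i * cs.simple j := by
  have h2 := cs.simple_mul_simple_pow i j
  have hM : simplyLacedCoxeterMatrix G i j = 3 := by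
    change (if i = j then 1 else if G.Adj i j then 3 else 2) = 3
    simp [h.ne, h]
  rw [hM] at h2
  have h3 : (cs.simple i * cs.simple j * cs.simple i) *
      (cs.simple j * cs.simple i * cs.simple j) = 1 := by
    rw [← h2, pow_succ, pow_two]; simp only [mul_assoc]
  rw [eq_inv_of_mul_eq_one_left h3, mul_inv_rev, mul_inv_rev, cs.inv_simple, cs.inv_simple,
    mul_assoc]

end SimplyLaced

/-! ### The numbers game: the Weyl group acting on weights. -/

section NumbersGame

open Classical in
/-- The pairing of the weight `lam - ∑ n_j α_j` with the simple coroot of index `i`, in the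
simply-laced root system of the graph `G`. -/
noncomputable def gamePairing {I : Type*} [Fintype I] (G : SimpleGraph I) (lam n : I → ℤ) (i : I) :
    ℤ :=
  lam i - 2 * n i + ∑ j with G.Adj i j, n j

open Classical in
/-- The reflection of index `i`, acting on the coefficients `n` of the weight
`lam - ∑ n_j α_j`. -/
noncomputable def gameMove {I : Type*} [Fintype I] (G : SimpleGraph I) (lam : I → ℤ) (i : I)
    (n : I → ℤ) : I → ℤ :=
  n + Pi.single i (gamePairing G lam n i)

variable {I : Type*} [Fintype I] {G : SimpleGraph I} {lam : I → ℤ}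

open Classical in
theorem gamePairing_add_single (n : I → ℤ) (i j : I) (a : ℤ) :
    gamePairing G lam (n + Pi.single j a) i =
      gamePairing G lam n i - (if i = j then 2 * a else 0) + (if G.Adj i j then a else 0) := by
  have h : ∑ k with G.Adj i k, (Pi.single j a : I → ℤ) k = if G.Adj i j then a else 0 := by
    rw [Finset.sum_filter]
    simp only [Pi.single_apply]
    rw [Finset.sum_eq_single j]
    · simp
    · intro b _ hb
      simp [hb]
    · simp
  simp only [gamePairing, Pi.add_apply, Finset.sum_add_distrib, h]
  by_cases hij : i = j
  · subst hij; simp; ring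
  · simp [hij]; ring

theorem gamePairing_gameMove_self (n : I → ℤ) (i : I) :
    gamePairing G lam (gameMove G lam i n) i = -gamePairing G lam n i := by
  rw [gameMove, gamePairing_add_single]
  simp; ring

theorem gamePairing_gameMove_of_adj {i j : I} (h : G.Adj i j) (n : I → ℤ) :
    gamePairing G lam (gameMove G lam j n) i = gamePairing G lam n i + gamePairing G lam n j := by
  rw [gameMove, gamePairing_add_single]
  simp [h, h.ne]

theorem gamePairing_gameMove_of_not_adj {i j : I} (hij : i ≠ j) (h : ¬ G.Adj i j) (n : I → ℤ) :
    gamePairing G lam (gameMove G lam j n) i = gamePairing G lam n i := by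
  rw [gameMove, gamePairing_add_single]
  simp [h, hij]

open Classical in
theorem gameMove_involutive (i : I) : Function.Involutive (gameMove G lam i) := by
  intro n
  rw [gameMove, gamePairing_gameMove_self, gameMove, Pi.single_neg]
  abel

theorem gameMove_comm {i j : I} (hij : i ≠ j) (h : ¬ G.Adj i j) (n : I → ℤ) :
    gameMove G lam i (gameMove G lam j n) = gameMove G lam j (gameMove G lam i n) := by
  rw [gameMove, gamePairing_gameMove_of_not_adj hij h, gameMove, gameMove,
    gamePairing_gameMove_of_not_adj hij.symm (fun h' => h h'.symm), gameMove]
  abel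

-- If the pairings at `i` and `j` are a and b, the successive moves add a, a + b, b on one side and
-- b, a + b, a on the other; both coordinates gain a + b either way.
open Classical in
theorem gameMove_braid {i j : I} (h : G.Adj i j) (n : I → ℤ) :
    gameMove G lam i (gameMove G lam j (gameMove G lam i n)) =
      gameMove G lam j (gameMove G lam i (gameMove G lam j n)) := by
  have e1 : gamePairing G lam (gameMove G lam j (gameMove G lam i n)) i =
      gamePairing G lam n j := by
    rw [gamePairing_gameMove_of_adj h, gamePairing_gameMove_self,
      gamePairing_gameMove_of_adj h.symm]
    ring
  have e2 : gamePairing G lam (gameMove G lam i (gameMove G lam j n)) j =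
      gamePairing G lam n i := by
    rw [gamePairing_gameMove_of_adj h.symm, gamePairing_gameMove_self,
      gamePairing_gameMove_of_adj h]
    ring
  rw [gameMove, e1, gameMove, gamePairing_gameMove_of_adj h.symm, gameMove, gameMove, e2, gameMove,
    gamePairing_gameMove_of_adj h, gameMove, Pi.single_add, Pi.single_add]
  abel

variable (G lam) in
/-- The reflection of index `i` as a permutation. -/
noncomputable def gamePerm (i : I) : Equiv.Perm (I → ℤ) :=
  (gameMove_involutive (G := G) (lam := lam) i).toPerm

theorem gamePerm_mul_self (i : I) : gamePerm G lam i * gamePerm G lam i = 1 :=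
  Equiv.ext fun n => gameMove_involutive i n

open Classical in
variable (G lam) in
theorem gamePerm_isLiftable : (simplyLacedCoxeterMatrix G).IsLiftable (gamePerm G lam) := by
  intro i j
  change (gamePerm G lam i * gamePerm G lam j) ^
    (if i = j then 1 else if G.Adj i j then 3 else 2) = 1
  split_ifs with h1 h2
  · rw [h1, pow_one, gamePerm_mul_self]
  · have hb : gamePerm G lam i * gamePerm G lam j * gamePerm G lam i =
        gamePerm G lam j * gamePerm G lam i * gamePerm G lam j :=
      Equiv.ext fun n => gameMove_braid h2 n
    calc (gamePerm G lam i * gamePerm G lam j) ^ 3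
        = (gamePerm G lam i * gamePerm G lam j * gamePerm G lam i) *
            (gamePerm G lam j * gamePerm G lam i * gamePerm G lam j) := by
          simp only [pow_succ, pow_zero, one_mul, mul_assoc]
      _ = gamePerm G lam i * gamePerm G lam j * (gamePerm G lam i * gamePerm G lam i) *
            gamePerm G lam j * gamePerm G lam i := by rw [← hb]; group
      _ = gamePerm G lam i * (gamePerm G lam j * gamePerm G lam j) * gamePerm G lam i := by
            rw [gamePerm_mul_self, mul_one]; group
      _ = 1 := by rw [gamePerm_mul_self, mul_one, gamePerm_mul_self]
  · have hb : gamePerm G lam i * gamePerm G lam j = gamePerm G lam j * gamePerm G lam i :=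
      Equiv.ext fun n => gameMove_comm h1 h2 n
    rw [pow_two, mul_assoc, hb, ← mul_assoc (gamePerm G lam j),
      gamePerm_mul_self, one_mul, gamePerm_mul_self]

variable {W : Type*} [Group W] (cs : CoxeterSystem (simplyLacedCoxeterMatrix G) W)

variable (lam) in
/-- The position reached by letting `w` act on the start position: the coefficients of
`lam - w lam` in the basis of simple roots. -/
noncomputable def gamePosition (w : W) : I → ℤ :=
  cs.lift ⟨gamePerm G lam, gamePerm_isLiftable G lam⟩ w 0

theorem gamePosition_one : gamePosition lam cs 1 = 0 := by simp [gamePosition]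

theorem gamePosition_simple_mul (i : I) (w : W) :
    gamePosition lam cs (cs.simple i * w) = gameMove G lam i (gamePosition lam cs w) := by
  rw [gamePosition, map_mul, cs.lift_apply_simple (gamePerm_isLiftable G lam)]
  rfl

/-- If `s_i` lengthens `w`, then the pairing of `w lam` with the simple coroot of index `i` is
bounded below by any common lower bound `m ≥ 0` of the coordinates of `lam`. -/
theorem le_gamePairing_of_not_isLeftDescent {m : ℤ} (hm : 0 ≤ m) (hlam : ∀ i, m ≤ lam i) (w : W)
    (i : I) (h : ¬ cs.IsLeftDescent w i) :
    m ≤ gamePairing G lam (gamePosition lam cs w) i := by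
  induction hl : cs.length w using Nat.strong_induction_on generalizing w i with
  | _ l ih =>
    by_cases hw : w = 1
    · subst hw
      simpa [gamePosition_one, gamePairing] using hlam i
    obtain ⟨t, ht⟩ := cs.exists_leftDescent_of_ne_one hw
    have hti : i ≠ t := by rintro rfl; exact h ht
    obtain ⟨w', rfl⟩ : ∃ w', w = cs.simple t * w' := ⟨cs.simple t * w, by simp⟩
    have hlw := (cs.isLeftDescent_iff).1 ht
    rw [cs.simple_mul_simple_cancel_left] at hlw
    have hli := (cs.not_isLeftDescent_iff).1 h
    rw [gamePosition_simple_mul]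
    by_cases hadj : G.Adj i t
    · rw [gamePairing_gameMove_of_adj hadj]
      have htw' : ¬ cs.IsLeftDescent w' t := by
        rw [cs.not_isLeftDescent_iff]; exact hlw.symm
      by_cases hiw' : cs.IsLeftDescent w' i
      -- For w = s_t s_i w'' the pairing at `i` is that of w'' at `t`. If `t` were a descent of w'',
      -- the braid relation would give s_i w = s_t s_i (s_t w''), of length at most l(w'') + 1
      -- rather than l(w'') + 3.
      · obtain ⟨w'', rfl⟩ : ∃ w'', w' = cs.simple i * w'' := ⟨cs.simple i * w', by simp⟩
        have hl' := (cs.isLeftDescent_iff).1 hiw'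
        rw [cs.simple_mul_simple_cancel_left] at hl'
        have key : ¬ cs.IsLeftDescent w'' t := by
          intro hd
          have hd' := (cs.isLeftDescent_iff).1 hd
          have e : cs.simple i * (cs.simple t * (cs.simple i * w'')) =
              cs.simple t * (cs.simple i * (cs.simple t * w'')) := by
            simp only [← mul_assoc]; rw [cs.simple_braid_of_adj hadj]
          rw [e] at hli
          have h1 := cs.length_simple_mul (cs.simple i * (cs.simple t * w'')) t
          have h2 := cs.length_simple_mul (cs.simple t * w'') i
          omega
        have := ih _ (by omega) w'' t key rfl
        rw [gamePosition_simple_mul, gamePairing_gameMove_self,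
          gamePairing_gameMove_of_adj hadj.symm]
        linarith
      · have h1 := ih _ (by omega) w' i hiw' rfl
        have h2 := ih _ (by omega) w' t htw' rfl
        linarith
    · rw [gamePairing_gameMove_of_not_adj hti hadj]
      refine ih _ (by omega) w' i ?_ rfl
      intro hd
      have hd' := (cs.isLeftDescent_iff).1 hd
      rw [← mul_assoc, cs.simple_mul_simple_comm_of_not_adj hti hadj, mul_assoc] at hli
      have h1 := cs.length_simple_mul (cs.simple i * w') t
      omega

/-- The weight with all coordinates 1 is regular: the bound with `m = 1`, applied to w or to s_i w,
rules out a zero pairing, so the sign decides. -/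
theorem isLeftDescent_iff_gamePairing_one_neg (w : W) (i : I) :
    cs.IsLeftDescent w i ↔ gamePairing G 1 (gamePosition 1 cs w) i < 0 := by
  constructor
  · intro h
    have h1 := le_gamePairing_of_not_isLeftDescent (lam := 1) (m := 1) cs (by norm_num)
      (fun _ => by simp) _ i (cs.isLeftDescent_iff_not_isLeftDescent_mul.1 h)
    rw [gamePosition_simple_mul, gamePairing_gameMove_self] at h1
    linarith
  · intro h
    by_contra h'
    have h1 := le_gamePairing_of_not_isLeftDescent (lam := 1) (m := 1) cs (by norm_num)
      (fun _ => by simp) _ i h'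
    linarith

theorem isLeftDescent_simple_mul_iff {i j : I} (hij : i ≠ j) (h : ¬ G.Adj i j) (w : W) :
    cs.IsLeftDescent (cs.simple j * w) i ↔ cs.IsLeftDescent w i := by
  rw [isLeftDescent_iff_gamePairing_one_neg, isLeftDescent_iff_gamePairing_one_neg,
    gamePosition_simple_mul, gamePairing_gameMove_of_not_adj hij h]

end NumbersGame

/-! ### Demazure multiplication by simple reflections. -/

section Demazure

variable {I W : Type*} [Group W] {M : CoxeterMatrix I} (cs : CoxeterSystem M W)

theorem simpleDemazureMul_of_isLeftDescent {i : I} {w : W} (h : cs.IsLeftDescent w i) :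
    simpleDemazureMul cs i w = w := by
  rw [simpleDemazureMul, if_neg]
  rw [CoxeterSystem.IsLeftDescent] at h
  omega

theorem simpleDemazureMul_of_not_isLeftDescent {i : I} {w : W} (h : ¬ cs.IsLeftDescent w i) :
    simpleDemazureMul cs i w = cs.simple i * w := by
  rw [simpleDemazureMul, if_pos]
  exact cs.not_isLeftDescent_iff.1 h

theorem simpleDemazureMul_self (i : I) (w : W) :
    simpleDemazureMul cs i (simpleDemazureMul cs i w) = simpleDemazureMul cs i w := by
  by_cases h : cs.IsLeftDescent w i
  · rw [simpleDemazureMul_of_isLeftDescent cs h, simpleDemazureMul_of_isLeftDescent cs h]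
  · rw [simpleDemazureMul_of_not_isLeftDescent cs h, simpleDemazureMul_of_isLeftDescent]
    rw [cs.isLeftDescent_iff_not_isLeftDescent_mul]
    simpa using h

theorem simpleDemazureMul_comm {I W : Type*} [Finite I] [Group W] {G : SimpleGraph I}
    (cs : CoxeterSystem (simplyLacedCoxeterMatrix G) W) {i j : I} (h : ¬ G.Adj i j) (w : W) :
    simpleDemazureMul cs i (simpleDemazureMul cs j w) =
      simpleDemazureMul cs j (simpleDemazureMul cs i w) := by
  have := Fintype.ofFinite I
  obtain rfl | hij := eq_or_ne i j
  · rfl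
  have h1 := isLeftDescent_simple_mul_iff cs hij h w
  have h2 := isLeftDescent_simple_mul_iff cs hij.symm (fun h' => h h'.symm) w
  by_cases hi : cs.IsLeftDescent w i <;> by_cases hj : cs.IsLeftDescent w j
  · simp only [simpleDemazureMul_of_isLeftDescent cs hi, simpleDemazureMul_of_isLeftDescent cs hj]
  · rw [simpleDemazureMul_of_isLeftDescent cs hi, simpleDemazureMul_of_not_isLeftDescent cs hj,
      simpleDemazureMul_of_isLeftDescent cs (h1.2 hi)]
  · rw [simpleDemazureMul_of_isLeftDescent cs hj, simpleDemazureMul_of_not_isLeftDescent cs hi,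
      simpleDemazureMul_of_isLeftDescent cs (h2.2 hj)]
  · rw [simpleDemazureMul_of_not_isLeftDescent cs hi, simpleDemazureMul_of_not_isLeftDescent cs hj,
      simpleDemazureMul_of_not_isLeftDescent cs (fun h => hi (h1.1 h)),
      simpleDemazureMul_of_not_isLeftDescent cs (fun h => hj (h2.1 h)), ← mul_assoc,
      cs.simple_mul_simple_comm_of_not_adj hij h, mul_assoc]

theorem foldr_simpleDemazureMul_comm {I W : Type*} [Finite I] [Group W] {G : SimpleGraph I}
    (cs : CoxeterSystem (simplyLacedCoxeterMatrix G) W) {i : I} (l : List I)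
    (h : ∀ j ∈ l, ¬ G.Adj i j) (w : W) :
    l.foldr (simpleDemazureMul cs) (simpleDemazureMul cs i w) =
      simpleDemazureMul cs i (l.foldr (simpleDemazureMul cs) w) := by
  induction l with
  | nil => rfl
  | cons j l ih =>
    rw [List.foldr_cons, List.foldr_cons, ih fun k hk => h k (List.mem_cons_of_mem _ hk),
      simpleDemazureMul_comm cs (h j List.mem_cons_self)]

end Demazure

theorem nonempty_orderIso_of_surjOn {α β : Type*} [PartialOrder α] [PartialOrder β] {S : Set α}
    {T : Set β} (f : α → β) (hf : Set.MapsTo f S T) (hs : Set.SurjOn f S T)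
    (hle : ∀ a ∈ S, ∀ b ∈ S, f a ≤ f b ↔ a ≤ b) : Nonempty (S ≃o T) := by
  let g : S ↪o T := OrderEmbedding.ofMapLEIff (hf.restrict f S T)
    fun a b => hle a a.2 b b.2
  refine ⟨RelIso.ofSurjective g ?_⟩
  exact hf.restrict_surjective_iff.2 hs

/-! ### Double-tailed diamonds and the Dynkin diagram of a d-complete poset. -/

section DComplete

variable {P : Type*} [PartialOrder P]

theorem isDMinusInterval_three {v x y : P} (hx : v ⋖ x) (hy : v ⋖ y) (hxy : x ≠ y) :
    IsDMinusInterval 3 ({v, x, y} : Set P) := by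
  classical
  have hxy' : ¬ x ≤ y := fun h => hx.lt.ne (((hy.eq_or_eq hx.le h).resolve_right hxy).symm)
  have hyx' : ¬ y ≤ x := fun h => hy.lt.ne (((hx.eq_or_eq hy.le h).resolve_right hxy.symm).symm)
  refine ⟨le_rfl, ⟨?_⟩, ?_⟩
  · intro a ha b hb z hz
    have hvz : v ≤ z := by
      refine le_trans ?_ hz.1
      rcases ha with rfl | rfl | rfl
      exacts [le_rfl, hx.le, hy.le]
    rcases hb with rfl | rfl | rfl
    · left; exact le_antisymm hz.2 hvz
    · rcases hx.eq_or_eq hvz hz.2 with h | h <;> simp [h]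
    · rcases hy.eq_or_eq hvz hz.2 with h | h <;> simp [h]
  · have hvx := hx.lt.ne
    have hvy := hy.lt.ne
    have hxv := hx.lt.not_ge
    have hyv := hy.lt.not_ge
    have hT : doubleTailedDiamondMinus 3 = {(0, 0), (1, 0), (0, 1)} := by
      ext ⟨a, b⟩
      simp only [doubleTailedDiamondMinus, doubleTailedDiamond, Set.mem_sdiff, Set.mem_ofPred_eq,
        Set.mem_insert_iff, Set.mem_singleton_iff, Prod.mk.injEq]
      omega
    rw [hT]
    refine nonempty_orderIso_of_surjOn
      (fun z => if z = v then (0, 0) else if z = x then (1, 0) else (0, 1)) ?_ ?_ ?_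
    · intro z _
      dsimp only
      split_ifs <;> simp
    · rintro q (rfl | rfl | rfl)
      · exact ⟨v, by simp⟩
      · exact ⟨x, by simp [hvx.symm]⟩
      · exact ⟨y, by simp [hvy.symm, hxy.symm]⟩
    · rintro a (rfl | rfl | rfl) b (rfl | rfl | rfl) <;>
        simp [hvx.symm, hvy.symm, hxy.symm, hxy', hyx', hxv, hyv, hx.le, hy.le]

/-- As `w` is the only cover of `v`, the interval [v, t] is [w, t] with a new bottom. Shifting the
model of d_k by (1, 1) frees (0, 0) for `v` and stops just below the top of d_{k+1}. -/
theorem isDMinusInterval_succ {k : ℕ} {v w t : P} (hvw : v ⋖ w) (huniq : ∀ z, v ⋖ z → z = w)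
    (hwt : w ≤ t) [IsStronglyAtomic P] (h : IsDInterval k w t) :
    IsDMinusInterval (k + 1) (Set.Icc v t) := by
  classical
  obtain ⟨hk, ⟨e⟩⟩ := h
  have hS : ∀ z ∈ Set.Icc v t, z ≠ v → z ∈ Set.Icc w t := by
    intro z hz hzv
    obtain ⟨z', h1, h2⟩ := exists_covBy_le_of_lt (lt_of_le_of_ne hz.1 hzv.symm)
    exact ⟨huniq z' h1 ▸ h2, hz.2⟩
  have hwv : ∀ z ∈ Set.Icc w t, z ≠ v := by
    rintro z hz rfl
    exact hvw.lt.not_ge hz.1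
  refine ⟨by omega, Set.ordConnected_Icc, ?_⟩
  have hmem : ∀ a b, (a, b) ∈ doubleTailedDiamond k ↔
      (a + 1, b + 1) ∈ doubleTailedDiamondMinus (k + 1) := by
    intro a b
    simp only [doubleTailedDiamondMinus, doubleTailedDiamond, Set.mem_sdiff, Set.mem_ofPred_eq,
      Set.mem_singleton_iff, Prod.mk.injEq]
    omega
  have hpos : ∀ a b, (a, b) ∈ doubleTailedDiamondMinus (k + 1) → (a, b) ≠ (0, 0) →
      1 ≤ a ∧ 1 ≤ b := by
    intro a b
    simp only [doubleTailedDiamondMinus, doubleTailedDiamond, Set.mem_sdiff, Set.mem_ofPred_eq,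
      Set.mem_singleton_iff, Prod.mk.injEq, ne_eq]
    omega
  have h0 : (0, 0) ∈ doubleTailedDiamondMinus (k + 1) := by
    refine ⟨.inl ⟨rfl, ?_⟩, fun h => ?_⟩
    · change 0 < 2 * (k + 1) - 4
      omega
    · have := congrArg Prod.fst (Set.mem_singleton_iff.1 h)
      dsimp only at this
      omega
  let f : P → ℕ × ℕ := fun z =>
    if hz : z ∈ Set.Icc w t then ((e ⟨z, hz⟩ : ℕ × ℕ).1 + 1, (e ⟨z, hz⟩ : ℕ × ℕ).2 + 1)
    else (0, 0)
  have fv : f v = (0, 0) := dif_neg fun hv => hwv v hv rfl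
  have fz : ∀ z (hz : z ∈ Set.Icc w t),
      f z = ((e ⟨z, hz⟩ : ℕ × ℕ).1 + 1, (e ⟨z, hz⟩ : ℕ × ℕ).2 + 1) := fun z hz => dif_pos hz
  refine nonempty_orderIso_of_surjOn f ?_ ?_ ?_
  · intro z hz
    by_cases hzv : z = v
    · rw [hzv, fv]; exact h0
    · rw [fz z (hS z hz hzv), ← hmem]
      exact (e ⟨z, hS z hz hzv⟩).2
  · rintro ⟨a, b⟩ hq
    by_cases hq0 : (a, b) = (0, 0)
    · exact ⟨v, ⟨le_rfl, hvw.le.trans hwt⟩, by rw [fv, hq0]⟩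
    · obtain ⟨ha, hb⟩ := hpos a b hq hq0
      obtain ⟨a, rfl⟩ := Nat.exists_eq_add_of_le' ha
      obtain ⟨b, rfl⟩ := Nat.exists_eq_add_of_le' hb
      have hab := (hmem a b).2 hq
      refine ⟨e.symm ⟨(a, b), hab⟩, ⟨hvw.le.trans (e.symm ⟨(a, b), hab⟩).2.1,
        (e.symm ⟨(a, b), hab⟩).2.2⟩, ?_⟩
      rw [fz _ (e.symm ⟨(a, b), hab⟩).2]
      simp
  · intro a ha b hb
    by_cases hav : a = v
    · rw [hav, fv]
      exact ⟨fun _ => hb.1, fun _ => ⟨Nat.zero_le _, Nat.zero_le _⟩⟩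
    · have ha' := hS a ha hav
      by_cases hbv : b = v
      · rw [hbv, fv, fz a ha']
        refine ⟨fun h => absurd h.1 (by simp), fun h => absurd (le_antisymm h ha.1) hav⟩
      · have hb' := hS b hb hbv
        rw [fz a ha', fz b hb', ← Subtype.mk_le_mk (p := (· ∈ Set.Icc w t)) (hx := ha')
          (hy := hb'), ← e.le_iff_le, ← Subtype.coe_le_coe, Prod.le_def, Prod.le_def]
        simp

/-- (D1) does not name the bottom of the completed interval. It lies below `v` and belongs to `S ∪
{u}`, hence it is `v`. -/
theorem IsDComplete.exists_dInterval [Finite P] (hP : IsDComplete P) {k : ℕ} {S : Set P} {v : P}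
    (hS : IsDMinusInterval k S) (hv : IsLeast S v) :
    ∃ u, IsDInterval k v u ∧ Set.Icc v u = insert u S ∧ v < u ∧
      ∀ x, Maximal (fun y => y ∈ S) x → x ⋖ u := by
  obtain ⟨v', u, h1, h2, h3⟩ := hP.exists_top k S hS
  obtain ⟨m, hvm, hm⟩ := (Set.toFinite S).exists_le_maximal hv.1
  have hvu : v < u := lt_of_le_of_lt hvm (h3 m hm).lt
  have hvv : v' ≤ v := by
    have : v ∈ Set.Icc v' u := h2 ▸ Set.mem_insert_of_mem u hv.1
    exact this.1
  have hv' : v' ∈ insert u S := h2 ▸ ⟨le_rfl, hvv.trans hvu.le⟩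
  have : v' = v := by
    rcases hv' with rfl | hv'
    · exact absurd hvv hvu.not_ge
    · exact le_antisymm hvv (hv.2 hv')
  subst this
  exact ⟨u, h1, h2, hvu, h3⟩

/-- `[v, u]` is a double-tailed diamond with middle elements `x` and `y`, and the covers in `P` of
the elements of its lower tail belong to it. -/
inductive IsDiamond : P → P → P → P → Prop
  | base {v u x y : P} : x ≠ y → v ⋖ x → v ⋖ y → x ⋖ u → y ⋖ u →
      Set.Icc v u = {u, v, x, y} → (∀ z, v ⋖ z → z = x ∨ z = y) →
      (∃ k, IsDInterval k v u) → IsDiamond v u x y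
  | step {v u w t x y : P} : IsDiamond w t x y → v ⋖ w → (∀ z, v ⋖ z → z = w) → t ⋖ u →
      Set.Icc v u = insert u (Set.Icc v t) → (∃ k, IsDInterval k v u) → IsDiamond v u x y

theorem IsDiamond.isDInterval {v u x y : P} (h : IsDiamond v u x y) :
    ∃ k, IsDInterval k v u := by
  cases h <;> assumption

theorem IsDiamond.lt {v u x y : P} (h : IsDiamond v u x y) : v < x ∧ v < y ∧ x < u ∧ y < u := by
  induction h with
  | base _ hx hy hxu hyu => exact ⟨hx.lt, hy.lt, hxu.lt, hyu.lt⟩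
  | step _ hvw _ htu _ _ ih =>
    exact ⟨hvw.lt.trans ih.1, hvw.lt.trans ih.2.1, ih.2.2.1.trans htu.lt, ih.2.2.2.trans htu.lt⟩

theorem exists_two_covers_of_notMem_topForest {v : P} (hv : v ∉ topForest P)
    (h : ∀ z, v ⋖ z → z ∈ topForest P) [IsStronglyAtomic P] :
    ∃ x y, v ⋖ x ∧ v ⋖ y ∧ x ≠ y := by
  by_contra! hcon
  refine hv fun y hy z z' hz hz' => ?_
  rcases hy.eq_or_lt with rfl | hlt
  · exact hcon z z' hz hz'
  · obtain ⟨w, hw, hwy⟩ := exists_covBy_le_of_lt hlt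
    exact h w hw y hwy z z' hz hz'

theorem isUpperSet_topForest : IsUpperSet (topForest P) :=
  fun _ _ hab ha y hy => ha y (hab.trans hy)

variable {I : Type*} {c : P → I}

/-- A third cover `z` would give a d_3-interval from `v` through `x` and `z`, with top `u'` of the
same color as `u`. Both tops cover `x` and are comparable by (C1), so they coincide, which puts `z`
in {u, v, x, y}. -/
theorem covBy_eq_or_eq_of_covBy [Finite P] (hP : IsDComplete P) (hc : IsDCompleteColoring c)
    {v x y : P} {u : P} {k : ℕ} (hx : v ⋖ x) (hu : IsDInterval k v u) (hxu : x ⋖ u)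
    (hIcc : Set.Icc v u = {u, v, x, y}) (z : P) (hz : v ⋖ z) : z = x ∨ z = y := by
  by_contra! hcon
  have hle : IsLeast ({v, x, z} : Set P) v :=
    ⟨by simp, by rintro a (rfl | rfl | rfl); exacts [le_rfl, hx.le, hz.le]⟩
  obtain ⟨u', h1, h2, h3, h4⟩ :=
    hP.exists_dInterval (isDMinusInterval_three hx hz hcon.1.symm) hle
  have hxu' : x ⋖ u' := by
    refine h4 x ⟨by simp, ?_⟩
    rintro a (rfl | rfl | rfl) h
    · exact hx.le
    · exact le_rfl
    · exact ((hz.eq_or_eq hx.le h).resolve_left hx.lt.ne').ge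
  have hzu' : z ≤ u' := by
    have : z ∈ Set.Icc v u' := h2 ▸ by simp
    exact this.2
  have hcol : c u = c u' := (hc.eq_of_dInterval _ _ _ hu).symm.trans (hc.eq_of_dInterval _ _ _ h1)
  by_cases huu : u = u'
  · subst huu
    have : z ∈ Set.Icc v u := ⟨hz.le, hzu'⟩
    rw [hIcc] at this
    rcases this with rfl | rfl | rfl | rfl
    · exact hz.2 hx.lt hxu.lt
    · exact hz.lt.ne rfl
    · exact hcon.1 rfl
    · exact hcon.2 rfl
  · refine hc.ne_of_incomp u u' (fun h => ?_) (fun h => ?_) hcol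
    · exact hxu'.2 hxu.lt (lt_of_le_of_ne h huu)
    · exact hxu.2 hxu'.lt (lt_of_le_of_ne h (Ne.symm huu))

/-- Two covers of `v` span a d_3-interval by (D1). A single cover must itself lie outside the top
forest, and its diamond is extended by `v` below and, again by (D1), by a new top. -/
theorem exists_isDiamond [Finite P] (hP : IsDComplete P) (hc : IsDCompleteColoring c) (v : P)
    (hv : v ∉ topForest P) : ∃ u x y, IsDiamond v u x y := by
  induction v using WellFoundedGT.induction with
  | _ v ih =>
    by_cases h2 : ∃ x y, v ⋖ x ∧ v ⋖ y ∧ x ≠ y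
    · obtain ⟨x, y, hx, hy, hxy⟩ := h2
      have hle : IsLeast ({v, x, y} : Set P) v :=
        ⟨by simp, by rintro a (rfl | rfl | rfl); exacts [le_rfl, hx.le, hy.le]⟩
      obtain ⟨u, h1, h2, h3, h4⟩ := hP.exists_dInterval (isDMinusInterval_three hx hy hxy) hle
      have hxu : x ⋖ u := by
        refine h4 x ⟨by simp, ?_⟩
        rintro a (rfl | rfl | rfl) h
        · exact hx.le
        · exact le_rfl
        · exact ((hy.eq_or_eq hx.le h).resolve_left hx.lt.ne').ge
      have hyu : y ⋖ u := by
        refine h4 y ⟨by simp, ?_⟩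
        rintro a (rfl | rfl | rfl) h
        · exact hy.le
        · exact ((hx.eq_or_eq hy.le h).resolve_left hy.lt.ne').ge
        · exact le_rfl
      exact ⟨u, x, y, .base hxy hx hy hxu hyu h2
        (covBy_eq_or_eq_of_covBy hP hc hx h1 hxu h2) ⟨3, h1⟩⟩
    · have : ∃ w, v ⋖ w ∧ w ∉ topForest P := by
        by_contra! hcon
        exact h2 (exists_two_covers_of_notMem_topForest hv hcon)
      obtain ⟨w, hvw, hw⟩ := this
      obtain ⟨t, x, y, hd⟩ := ih w hvw.lt hw
      have huniq : ∀ z, v ⋖ z → z = w := fun z hz => by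
        by_contra hne
        exact h2 ⟨z, w, hz, hvw, hne⟩
      obtain ⟨k, hk⟩ := hd.isDInterval
      have hwt : w ≤ t := (hd.lt.1.trans hd.lt.2.2.1).le
      obtain ⟨u, h1, h3, h4, h5⟩ := hP.exists_dInterval (isDMinusInterval_succ hvw huniq hwt hk)
        ⟨⟨le_rfl, hvw.le.trans hwt⟩, fun z hz => hz.1⟩
      exact ⟨u, x, y, .step hd hvw huniq
        (h5 t ⟨⟨hvw.le.trans hwt, le_rfl⟩, fun z hz _ => hz.2⟩) h3 ⟨_, h1⟩⟩

/-- By (C3) the covering at the bottom of a diamond has the same two colors as one at its top, which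
the induction from above has already treated. -/
theorem IsDiamond.covBy_adj_of [Finite P] (hc : IsDCompleteColoring c) {v u x y z : P}
    (h : IsDiamond v u x y) (hz : v ⋖ z)
    (ih : ∀ a b, v < a → a ⋖ b → (dynkinDiagram c).Adj (c a) (c b)) :
    (dynkinDiagram c).Adj (c v) (c z) := by
  cases h with
  | base hxy hx hy hxu hyu hI huniq hd =>
    obtain ⟨k, hk⟩ := hd
    rw [hc.eq_of_dInterval k v u hk]
    rcases huniq z hz with rfl | rfl
    · exact (ih _ _ hx.lt hxu).symm
    · exact (ih _ _ hy.lt hyu).symm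
  | @step _ _ w t _ _ hw hvw huniq htu hI hd =>
    obtain ⟨k, hk⟩ := hd
    obtain ⟨k', hk'⟩ := hw.isDInterval
    rw [hc.eq_of_dInterval k v u hk, huniq z hz, hc.eq_of_dInterval k' _ _ hk']
    exact (ih _ _ (hvw.lt.trans (hw.lt.1.trans hw.lt.2.2.1)) htu).symm

theorem dynkinDiagram_adj_iff (hc : IsDCompleteColoring c) {x y : P} (hx : x ∈ topForest P)
    (hy : y ∈ topForest P) : (dynkinDiagram c).Adj (c x) (c y) ↔ x ⋖ y ∨ y ⋖ x := by
  have hinj := hc.bijOn_topForest.injOn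
  rw [dynkinDiagram, SimpleGraph.fromRel_adj]
  constructor
  · rintro ⟨_, ⟨a, ha, b, hb, hab, h1, h2⟩ | ⟨a, ha, b, hb, hab, h1, h2⟩⟩
    · rw [hinj ha hx h1, hinj hb hy h2] at hab; exact .inl hab
    · rw [hinj ha hy h1, hinj hb hx h2] at hab; exact .inr hab
  · intro h
    refine ⟨fun he => ?_, ?_⟩
    · rw [hinj hx hy he] at h
      rcases h with h | h <;> exact h.lt.ne rfl
    · rcases h with h | h
      · exact .inl ⟨x, hx, y, hy, h, rfl, rfl⟩
      · exact .inr ⟨y, hy, x, hx, h, rfl, rfl⟩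

theorem dynkinDiagram_adj_of_covBy [Finite P] (hP : IsDComplete P) (hc : IsDCompleteColoring c)
    (v z : P) (hz : v ⋖ z) : (dynkinDiagram c).Adj (c v) (c z) := by
  induction v using WellFoundedGT.induction generalizing z with
  | _ v ih =>
    by_cases hv : v ∈ topForest P
    · exact (dynkinDiagram_adj_iff hc hv (isUpperSet_topForest hz.le hv)).2 (.inl hz)
    · obtain ⟨u, x, y, h⟩ := exists_isDiamond hP hc v hv
      exact h.covBy_adj_of hc hz fun a b ha hab => ih a ha b hab

theorem exists_topForest_color (hc : IsDCompleteColoring c) (i : I) :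
    ∃ x ∈ topForest P, c x = i :=
  hc.bijOn_topForest.surjOn (Set.mem_univ i)

theorem dynkinDiagram_isAcyclic [Finite P] (hc : IsDCompleteColoring c) :
    (dynkinDiagram c).IsAcyclic := by
  classical
  intro v p hp
  choose g hg hcg using exists_topForest_color hc
  -- At a color whose top forest element is minimal on the cycle, both neighbors on the cycle must
  -- cover that element, and a top forest element has at most one cover.
  obtain ⟨i, hi, hmin⟩ : ∃ i ∈ p.support, ∀ j ∈ p.support, ¬ g j < g i := by
    obtain ⟨a, ha, hmin⟩ := WellFounded.has_min (wellFounded_lt (α := P))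
      (g '' {i | i ∈ p.support}) ⟨g v, v, p.start_mem_support, rfl⟩
    obtain ⟨i, hi, rfl⟩ := ha
    exact ⟨i, hi, fun j hj => hmin _ ⟨j, hj, rfl⟩⟩
  have hq := hp.rotate hi
  set q := p.rotate i hi with hqdef
  have hsup : ∀ j ∈ q.support, j ∈ p.support := by
    intro j hj
    exact (SimpleGraph.Walk.mem_support_rotate_iff _ _ _).1 hj
  have hcov : ∀ j, (dynkinDiagram c).Adj i j → j ∈ q.support → g i ⋖ g j := by
    intro j hadj hj
    rw [← hcg i, ← hcg j, dynkinDiagram_adj_iff hc (hg i) (hg j)] at hadj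
    exact hadj.resolve_right fun h => hmin j (hsup j hj) h.lt
  have h1 := hcov q.snd (q.adj_snd hq.not_nil) (q.getVert_mem_support 1)
  have h2 := hcov q.penultimate (q.adj_penultimate hq.not_nil).symm (q.getVert_mem_support _)
  have := hg i (g i) le_rfl _ _ h1 h2
  apply hq.snd_ne_penultimate
  rw [← hcg q.snd, this, hcg]

theorem exists_path_of_isChain [Finite P] (hP : IsDComplete P) (hc : IsDCompleteColoring c)
    (v z : P) (hvz : v ≤ z) (hch : IsChain (· ≤ ·) (Set.Icc v z)) :
    ∃ p : (dynkinDiagram c).Walk (c v) (c z), p.IsPath ∧ ∀ i ∈ p.support, i ∈ c '' Set.Icc v z := by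
  induction v using WellFoundedGT.induction with
  | _ v ih =>
    rcases hvz.eq_or_lt with rfl | hlt
    · exact ⟨.nil, by simp, by simp⟩
    · obtain ⟨w, hvw, hwz⟩ := exists_covBy_le_of_lt hlt
      have hsub : Set.Icc w z ⊆ Set.Icc v z := Set.Icc_subset_Icc_left hvw.le
      obtain ⟨p, hp, hps⟩ := ih w hvw.lt hwz (hch.mono hsub)
      refine ⟨.cons (dynkinDiagram_adj_of_covBy hP hc v w hvw) p, ?_, ?_⟩
      · rw [SimpleGraph.Walk.cons_isPath_iff]
        refine ⟨hp, fun h => ?_⟩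
        obtain ⟨a, ha, hca⟩ := hps _ h
        have := hc.injOn_chain v z hch (hsub ha) ⟨le_rfl, hvz⟩ hca
        exact hvw.lt.not_ge (this ▸ ha.1)
      · intro i hi
        rw [SimpleGraph.Walk.support_cons, List.mem_cons] at hi
        rcases hi with rfl | hi
        · exact ⟨v, ⟨le_rfl, hvz⟩, rfl⟩
        · exact Set.image_mono hsub (hps i hi)

/-- By (C2) the colors along the chain form a path of length at least 2 from `c v` to `c z`; in a
forest it excludes an edge between its ends. -/
theorem not_adj_of_isChain [Finite P] (hP : IsDComplete P) (hc : IsDCompleteColoring c)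
    {v m z : P} (hvm : v < m) (hmz : m < z) (hch : IsChain (· ≤ ·) (Set.Icc v z)) :
    ¬ (dynkinDiagram c).Adj (c v) (c z) := by
  intro hadj
  obtain ⟨w, hvw, hwm⟩ := exists_covBy_le_of_lt hvm
  have hsub : Set.Icc w z ⊆ Set.Icc v z := Set.Icc_subset_Icc_left hvw.le
  have hwz : w < z := hwm.trans_lt hmz
  obtain ⟨p, hp, hps⟩ := exists_path_of_isChain hP hc w z hwz.le (hch.mono hsub)
  have hq : (SimpleGraph.Walk.cons (dynkinDiagram_adj_of_covBy hP hc v w hvw) p).IsPath := by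
    rw [SimpleGraph.Walk.cons_isPath_iff]
    refine ⟨hp, fun h => ?_⟩
    obtain ⟨a, ha, hca⟩ := hps _ h
    have := hc.injOn_chain v z hch (hsub ha) ⟨le_rfl, (hvm.trans hmz).le⟩ hca
    exact hvw.lt.not_ge (this ▸ ha.1)
  have huniq := ((dynkinDiagram_isAcyclic hc).subsingleton_path (c v) (c z)).elim
    ⟨_, hq⟩ (SimpleGraph.Path.singleton hadj)
  have hlen := congrArg (fun q : (dynkinDiagram c).Path (c v) (c z) => q.1.length) huniq
  simp only [SimpleGraph.Path.singleton, SimpleGraph.Walk.length_cons,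
    SimpleGraph.Walk.length_nil, Nat.add_eq_right] at hlen
  have heq := SimpleGraph.Walk.eq_of_length_eq_zero hlen
  exact hwz.ne (hc.injOn_chain v z hch ⟨hvw.le, hwz.le⟩ ⟨(hvm.trans hmz).le, le_rfl⟩ heq)

end DComplete

/-! ### The next element of the same color, and comparability of adjacent colors. -/

section ColorSuccessor

variable {P : Type*} [PartialOrder P] {I : Type*} {c : P → I}

theorem isChain_Icc_of_covBy {v w x : P} [IsStronglyAtomic P] (huniq : ∀ z, v ⋖ z → z = w)
    (h : IsChain (· ≤ ·) (Set.Icc w x)) : IsChain (· ≤ ·) (Set.Icc v x) := by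
  have hsub : Set.Icc v x ⊆ insert v (Set.Icc w x) := by
    intro z hz
    rcases hz.1.eq_or_lt with rfl | hlt
    · exact Set.mem_insert _ _
    · obtain ⟨z', h1, h2⟩ := exists_covBy_le_of_lt hlt
      exact Set.mem_insert_of_mem _ ⟨huniq z' h1 ▸ h2, hz.2⟩
  have hsub' : Set.Icc v x ⊆ insert v (Set.Icc w x ∩ Set.Icc v x) := fun z hz =>
    (hsub hz).imp id fun h => ⟨h, hz⟩
  refine IsChain.mono hsub' ((h.mono Set.inter_subset_left).insert fun b hb _ => .inl hb.2.1)

theorem isChain_Icc_covBy {v x : P} (h : v ⋖ x) : IsChain (· ≤ ·) (Set.Icc v x) := by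
  have hsub : Set.Icc v x ⊆ {v, x} := fun z hz => h.eq_or_eq hz.1 hz.2
  refine IsChain.mono hsub ?_
  exact IsChain.insert (IsChain.singleton) fun b hb _ => .inl (hb ▸ h.le)

theorem IsDiamond.isChain [IsStronglyAtomic P] {v u x y : P} (h : IsDiamond v u x y) :
    IsChain (· ≤ ·) (Set.Icc v x) ∧ IsChain (· ≤ ·) (Set.Icc v y) := by
  induction h with
  | base _ hx hy => exact ⟨isChain_Icc_covBy hx, isChain_Icc_covBy hy⟩
  | step _ _ huniq _ _ _ ih =>
    exact ⟨isChain_Icc_of_covBy huniq ih.1, isChain_Icc_of_covBy huniq ih.2⟩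

theorem mem_Icc_of_unique_cover {v w t u z : P} [IsStronglyAtomic P]
    (huniq : ∀ z, v ⋖ z → z = w) (hI : Set.Icc v u = insert u (Set.Icc v t)) (h1 : v < z)
    (h2 : z < u) : z ∈ Set.Icc w t := by
  have h : z ∈ Set.Icc v u := ⟨h1.le, h2.le⟩
  rw [hI] at h
  obtain ⟨z', h3, h4⟩ := exists_covBy_le_of_lt h1
  exact ⟨huniq z' h3 ▸ h4, (h.resolve_left h2.ne).2⟩

/-- By (C3), applied to the nested diamonds, the upper tail repeats the colors of the lower one.
Questions about colors thus reduce to the chains [v, x] and [v, y], where (C2) applies. -/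
theorem IsDiamond.exists_color_eq [IsStronglyAtomic P] (hc : IsDCompleteColoring c) {v u x y : P}
    (h : IsDiamond v u x y) : ∀ z ∈ Set.Icc v u, ∃ z', (z' ∈ Set.Icc v x ∨ z' ∈ Set.Icc v y) ∧
      c z' = c z := by
  induction h with
  | base _ hx hy _ _ hI _ hd =>
    intro z hz
    rw [hI] at hz
    rcases hz with rfl | rfl | rfl | rfl
    · obtain ⟨k, hk⟩ := hd
      exact ⟨_, .inl ⟨le_rfl, hx.le⟩, hc.eq_of_dInterval k _ _ hk⟩
    · exact ⟨_, .inl ⟨le_rfl, hx.le⟩, rfl⟩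
    · exact ⟨_, .inl ⟨hx.le, le_rfl⟩, rfl⟩
    · exact ⟨_, .inr ⟨hy.le, le_rfl⟩, rfl⟩
  | @step v u w t x y hw hvw huniq htu hI hd ih =>
    intro z hz
    have hvx : v ≤ x := (hvw.lt.trans hw.lt.1).le
    rcases hz.1.eq_or_lt with rfl | h1
    · exact ⟨_, .inl ⟨le_rfl, hvx⟩, rfl⟩
    rcases hz.2.eq_or_lt with rfl | h2
    · obtain ⟨k, hk⟩ := hd
      exact ⟨_, .inl ⟨le_rfl, hvx⟩, hc.eq_of_dInterval k _ _ hk⟩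
    obtain ⟨z', hz', hcz⟩ := ih z (mem_Icc_of_unique_cover huniq hI h1 h2)
    exact ⟨z', hz'.imp (fun h => ⟨hvw.le.trans h.1, h.2⟩) (fun h => ⟨hvw.le.trans h.1, h.2⟩), hcz⟩

/-- `u` is the next element above `v` of the same color, and the elements of adjacent colors
strictly between them are as in a double-tailed diamond. -/
structure IsColorSuccessor (c : P → I) (v u : P) : Prop where
  lt : v < u
  isDInterval : ∃ k, IsDInterval k v u
  color_eq : c v = c u
  color_ne : ∀ z, v < z → z < u → c z ≠ c v
  lt_of_covBy : ∀ z, v ⋖ z → z < u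
  exists_adj : ∃ a b, a ≠ b ∧ v < a ∧ a < u ∧ v < b ∧ b < u ∧ (dynkinDiagram c).Adj (c a) (c v) ∧
    (dynkinDiagram c).Adj (c b) (c v) ∧
    (∀ z, v < z → z < u → (dynkinDiagram c).Adj (c z) (c v) → z = a ∨ z = b) ∧
    v ⋖ a ∧ (v ⋖ b ∨ c a = c b ∧ a < b)

theorem IsDiamond.color_ne [Finite P] (hP : IsDComplete P) (hc : IsDCompleteColoring c)
    {v u x y : P} (h : IsDiamond v u x y) : ∀ z, v < z → z < u → c z ≠ c v := by
  intro z h1 h2 hcz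
  have hch := h.isChain
  cases h with
  | base hxy hx hy hxu hyu hI huniq hd =>
    have : z ∈ Set.Icc v u := ⟨h1.le, h2.le⟩
    rw [hI] at this
    rcases this with rfl | rfl | rfl | rfl
    · exact h2.ne rfl
    · exact h1.ne rfl
    · exact (dynkinDiagram_adj_of_covBy hP hc _ _ hx).ne hcz.symm
    · exact (dynkinDiagram_adj_of_covBy hP hc _ _ hy).ne hcz.symm
  | step hw hvw huniq htu hI hd =>
    obtain ⟨z', hz', hcz'⟩ := hw.exists_color_eq hc z (mem_Icc_of_unique_cover huniq hI h1 h2)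
    rcases hz' with hz' | hz'
    · have hvx := (hvw.lt.trans hw.lt.1).le
      exact hvw.lt.not_ge (hc.injOn_chain _ _ hch.1 ⟨hvw.le.trans hz'.1, hz'.2⟩ ⟨le_rfl, hvx⟩
        (hcz'.trans hcz) ▸ hz'.1)
    · have hvy := (hvw.lt.trans hw.lt.2.1).le
      exact hvw.lt.not_ge (hc.injOn_chain _ _ hch.2 ⟨hvw.le.trans hz'.1, hz'.2⟩ ⟨le_rfl, hvy⟩
        (hcz'.trans hcz) ▸ hz'.1)

theorem IsDiamond.isColorSuccessor [Finite P] (hP : IsDComplete P) (hc : IsDCompleteColoring c)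
    {v u x y : P} (h : IsDiamond v u x y) : IsColorSuccessor c v u := by
  have hlt := h.lt
  have hcol : c v = c u := by
    obtain ⟨k, hk⟩ := h.isDInterval
    exact hc.eq_of_dInterval k v u hk
  refine ⟨hlt.1.trans hlt.2.2.1, h.isDInterval, hcol, h.color_ne hP hc, ?_, ?_⟩
  · intro z hz
    cases h with
    | base hxy hx hy hxu hyu hI huniq hd =>
      rcases huniq z hz with rfl | rfl
      exacts [hxu.lt, hyu.lt]
    | step hw hvw huniq htu hI hd =>
      rw [huniq z hz]
      exact (hw.lt.1.trans hw.lt.2.2.1).trans htu.lt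
  · have hch := h.isChain
    cases h with
    | base hxy hx hy hxu hyu hI huniq hd =>
      refine ⟨x, y, hxy, hx.lt, hxu.lt, hy.lt, hyu.lt,
        (dynkinDiagram_adj_of_covBy hP hc _ _ hx).symm,
        (dynkinDiagram_adj_of_covBy hP hc _ _ hy).symm, ?_, hx, .inl hy⟩
      intro z h1 h2 _
      have : z ∈ Set.Icc v u := ⟨h1.le, h2.le⟩
      rw [hI] at this
      rcases this with rfl | rfl | h | h
      · exact absurd rfl h2.ne
      · exact absurd rfl h1.ne
      · exact .inl h
      · exact .inr h
    | @step _ _ w t _ _ hw hvw huniq htu hI hd =>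
      have hwt : w < t := hw.lt.1.trans hw.lt.2.2.1
      have hcwt : c w = c t := by
        obtain ⟨k, hk⟩ := hw.isDInterval
        exact hc.eq_of_dInterval k w t hk
      have hadj := (dynkinDiagram_adj_of_covBy hP hc _ _ hvw).symm
      -- The two elements of adjacent colors are the ends of the inner diamond. The color of any
      -- other element also occurs strictly above `w` on a chain from `v`, too far away to be
      -- adjacent to `c v`.
      refine ⟨w, t, hwt.ne, hvw.lt, hwt.trans htu.lt, hvw.lt.trans hwt, htu.lt, hadj, hcwt ▸ hadj,
        ?_, hvw, .inr ⟨hcwt, hwt⟩⟩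
      intro z h1 h2 hz
      have hzI := mem_Icc_of_unique_cover huniq hI h1 h2
      by_contra! hne
      have hwz := lt_of_le_of_ne hzI.1 hne.1.symm
      have hcz := hw.color_ne hP hc z hwz (lt_of_le_of_ne hzI.2 hne.2)
      obtain ⟨z', hz', hcz'⟩ := hw.exists_color_eq hc z hzI
      have hwz' : w < z' := by
        refine lt_of_le_of_ne (hz'.elim (·.1) (·.1)) ?_
        rintro rfl
        exact hcz hcz'.symm
      refine not_adj_of_isChain hP hc hvw.lt hwz' ?_ (hcz' ▸ hz.symm)
      rcases hz' with hz' | hz'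
      · exact hch.1.mono (Set.Icc_subset_Icc_right hz'.2)
      · exact hch.2.mono (Set.Icc_subset_Icc_right hz'.2)

theorem exists_isColorSuccessor [Finite P] (hP : IsDComplete P) (hc : IsDCompleteColoring c)
    {v : P} (hv : v ∉ topForest P) : ∃ u, IsColorSuccessor c v u := by
  obtain ⟨u, x, y, h⟩ := exists_isDiamond hP hc v hv
  exact ⟨u, h.isColorSuccessor hP hc⟩

theorem IsDCompleteColoring.le_or_le (hc : IsDCompleteColoring c) {x y : P} (h : c x = c y) :
    x ≤ y ∨ y ≤ x := by
  by_contra! hcon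
  exact hc.ne_of_incomp x y hcon.1 hcon.2 h

/-- `y'` is one of the two elements of adjacent colors between `x` and `x'`. If it covers `x`, (D2)
puts `x` in [y, y']. Otherwise the other one, `a`, has the color of `y` and is below `y'`; since
`y'` is the next element after `y`, `a ≤ y`. -/
theorem IsColorSuccessor.le_or_le_of_lt (hP : IsDComplete P) (hc : IsDCompleteColoring c)
    {x x' y y' : P} (hx : IsColorSuccessor c x x') (hy : IsColorSuccessor c y y')
    (hadj : (dynkinDiagram c).Adj (c x) (c y)) (h1 : x < y') (h2 : y' < x') :
    x ≤ y ∨ y ≤ x := by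
  obtain ⟨a, b, -, hxa, -, -, -, -, -, huniq, hca, hb⟩ := hx.exists_adj
  obtain ⟨k, hk⟩ := hy.isDInterval
  have hcov : x ⋖ y' → y ≤ x := fun h => (hP.mem_of_covBy k y y' hk x h).1
  rcases huniq y' h1 h2 (hy.color_eq ▸ hadj.symm) with rfl | rfl
  · exact .inr (hcov hca)
  · rcases hb with hb | ⟨hab, hlt⟩
    · exact .inr (hcov hb)
    · rcases hc.le_or_le (hab.trans hy.color_eq.symm) with h | h
      · exact .inl (hxa.le.trans h)
      · rcases h.eq_or_lt with rfl | h
        · exact .inl hxa.le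
        · exact absurd (hab.trans hy.color_eq.symm) (hy.color_ne a h hlt)

theorem IsColorSuccessor.le_or_le_of_mem_topForest (hP : IsDComplete P)
    (hc : IsDCompleteColoring c) {x x' y : P} (hx : IsColorSuccessor c x x')
    (hy : y ∈ topForest P) (hadj : (dynkinDiagram c).Adj (c x) (c y)) (h : x' ≤ y ∨ y ≤ x') :
    x ≤ y ∨ y ≤ x := by
  rcases h with h | h
  · exact .inl (hx.lt.le.trans h)
  · rw [hx.color_eq, dynkinDiagram_adj_iff hc (isUpperSet_topForest h hy) hy] at hadj
    rcases hadj with hadj | hadj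
    · exact .inl (hx.lt.trans hadj.lt).le
    · obtain ⟨k, hk⟩ := hx.isDInterval
      exact .inl (hP.mem_of_covBy k x x' hk y hadj).1

/-- Induction from above on the pair, replacing entries by their color successors. The only tight
case is x < y' and y < x'; comparing x' with y' then reduces it to
`IsColorSuccessor.le_or_le_of_lt`. -/
theorem le_or_le_of_adj [Finite P] (hP : IsDComplete P) (hc : IsDCompleteColoring c)
    {x y : P} (hadj : (dynkinDiagram c).Adj (c x) (c y)) : x ≤ y ∨ y ≤ x := by
  suffices h : ∀ q : P × P, (dynkinDiagram c).Adj (c q.1) (c q.2) → q.1 ≤ q.2 ∨ q.2 ≤ q.1 from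
    h (x, y) hadj
  clear hadj x y
  intro q
  induction q using WellFoundedGT.induction with
  | _ q ih =>
    obtain ⟨x, y⟩ := q
    intro hadj
    dsimp only at hadj ⊢
    by_cases hx : x ∈ topForest P <;> by_cases hy : y ∈ topForest P
    · rcases (dynkinDiagram_adj_iff hc hx hy).1 hadj with h | h
      exacts [.inl h.le, .inr h.le]
    · obtain ⟨y', hy'⟩ := exists_isColorSuccessor hP hc hy
      have h := ih (x, y') (Prod.mk_lt_mk_iff_right.2 hy'.lt) (hy'.color_eq ▸ hadj)
      exact (hy'.le_or_le_of_mem_topForest hP hc hx hadj.symm h.symm).symm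
    · obtain ⟨x', hx'⟩ := exists_isColorSuccessor hP hc hx
      have h := ih (x', y) (Prod.mk_lt_mk_iff_left.2 hx'.lt) (hx'.color_eq ▸ hadj)
      exact hx'.le_or_le_of_mem_topForest hP hc hy hadj h
    · obtain ⟨x', hx'⟩ := exists_isColorSuccessor hP hc hx
      obtain ⟨y', hy'⟩ := exists_isColorSuccessor hP hc hy
      have h1 := ih (x, y') (Prod.mk_lt_mk_iff_right.2 hy'.lt) (hy'.color_eq ▸ hadj)
      have h2 := ih (x', y) (Prod.mk_lt_mk_iff_left.2 hx'.lt) (hx'.color_eq ▸ hadj)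
      have hadj' : (dynkinDiagram c).Adj (c x') (c y') := hx'.color_eq ▸ hy'.color_eq ▸ hadj
      have h3 := ih (x', y') (Prod.mk_lt_mk.2 (.inl ⟨hx'.lt, hy'.lt.le⟩)) hadj'
      dsimp only at h1 h2 h3
      rcases h1 with h1 | h1
      swap
      · exact .inr (hy'.lt.le.trans h1)
      rcases h2 with h2 | h2
      · exact .inl (hx'.lt.le.trans h2)
      have h1' : x < y' := lt_of_le_of_ne h1 fun he => hadj.ne (he ▸ hy'.color_eq.symm)
      have h2' : y < x' := lt_of_le_of_ne h2 fun he => hadj.ne (he ▸ hx'.color_eq)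
      rcases h3 with h3 | h3
      · exact (hy'.le_or_le_of_lt hP hc hx' hadj.symm h2'
          (lt_of_le_of_ne h3 fun he => hadj'.ne (congrArg c he))).symm
      · exact hx'.le_or_le_of_lt hP hc hy' hadj h1'
          (lt_of_le_of_ne h3 fun he => hadj'.ne (congrArg c he.symm))

end ColorSuccessor

/-! ### Pairings of coroots with the weights of filters. -/

section ColorCount

variable {P : Type*} [PartialOrder P] {I : Type*} {c : P → I}

/-- The number of elements of each color in `S`. -/
noncomputable def colorCount {P I : Type*} (c : P → I) (S : Set P) (i : I) : ℤ :=
  ({x | x ∈ S ∧ c x = i}.ncard : ℤ)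

open Classical in
/-- The sum of the fundamental weights of the colors of the maximal elements. -/
noncomputable def topWeight (c : P → I) (i : I) : ℤ :=
  if ∃ x, IsMax x ∧ c x = i then 1 else 0

theorem topWeight_nonneg (i : I) : 0 ≤ topWeight c i := by
  rw [topWeight]
  split_ifs <;> norm_num

theorem gamePairing_colorCount {P I : Type*} [Finite P] [Fintype I] {c : P → I}
    (G : SimpleGraph I) (lam : I → ℤ) (S : Set P) (i : I) :
    gamePairing G lam (colorCount c S) i =
      lam i - 2 * ({x | x ∈ S ∧ c x = i}.ncard : ℤ) +
        ({x | x ∈ S ∧ G.Adj i (c x)}.ncard : ℤ) := by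
  classical
  have := Fintype.ofFinite P
  have key : ∀ p : P → Prop, {x | p x}.ncard = (Finset.univ.filter p).card := fun p => by
    rw [← Set.ncard_coe_finset]
    simp
  rw [gamePairing, key fun x => x ∈ S ∧ G.Adj i (c x), Finset.card_eq_sum_card_fiberwise
    (f := c) (t := Finset.univ.filter (G.Adj i))
    (fun x hx => by simpa using (by simpa using hx : x ∈ S ∧ G.Adj i (c x)).2)]
  rw [Nat.cast_sum, colorCount]
  congr 1
  refine Finset.sum_congr (by congr) fun j hj => ?_
  rw [colorCount, key, Finset.filter_filter]
  congr 2
  ext x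
  have hj' : G.Adj i j := by simpa using hj
  simp only [Finset.mem_filter, Finset.mem_univ, true_and]
  constructor
  · rintro ⟨h, rfl⟩; exact ⟨⟨h, hj'⟩, rfl⟩
  · rintro ⟨⟨h, -⟩, rfl⟩; exact ⟨h, rfl⟩

open Classical in
theorem colorCount_insert {P I : Type*} [Finite P] {c : P → I} {S : Set P} {v : P} (hv : v ∉ S) :
    colorCount c (insert v S) = colorCount c S + Pi.single (c v) 1 := by
  ext i
  rw [Pi.add_apply, Pi.single_apply, colorCount, colorCount]
  split_ifs with h
  · subst h
    have : {x | x ∈ insert v S ∧ c x = c v} = insert v {x | x ∈ S ∧ c x = c v} := by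
      ext x
      simp only [Set.mem_ofPred_eq, Set.mem_insert_iff]
      constructor
      · rintro ⟨rfl | h, h'⟩
        exacts [.inl rfl, .inr ⟨h, h'⟩]
      · rintro (rfl | h)
        exacts [⟨.inl rfl, rfl⟩, ⟨.inr h.1, h.2⟩]
    rw [this, Set.ncard_insert_of_notMem (by simp [hv])]
    simp
  · have : {x | x ∈ insert v S ∧ c x = i} = {x | x ∈ S ∧ c x = i} := by
      ext x
      simp only [Set.mem_ofPred_eq, Set.mem_insert_iff]
      constructor
      · rintro ⟨rfl | h, h'⟩
        exacts [absurd h'.symm ‹_›, ⟨h, h'⟩]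
      · exact fun h => ⟨.inr h.1, h.2⟩
    rw [this, add_zero]

theorem colorCount_empty {P I : Type*} {c : P → I} : colorCount c (∅ : Set P) = 0 := by
  ext i
  simp [colorCount]

/-- Elements of one color form a chain. If `x` is in `D` but not in `F`, all elements of `F` of its
color lie above `x`, hence in `D`, and `F` has strictly fewer of them. -/
theorem subset_of_colorCount_eq [Finite P] (hc : IsDCompleteColoring c) {D F : Set P}
    (hD : IsUpperSet D) (hF : IsUpperSet F) (h : colorCount c D = colorCount c F) : D ⊆ F := by
  intro x hx
  by_contra hxF
  have h1 := congrFun h (c x)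
  rw [colorCount, colorCount, Nat.cast_inj] at h1
  refine (Set.ncard_lt_ncard (t := {z | z ∈ D ∧ c z = c x}) (Set.ssubset_iff_subset_ne.2
    ⟨fun y hy => ⟨?_, hy.2⟩, fun he => ?_⟩)).ne h1.symm
  · rcases hc.le_or_le hy.2 with h | h
    · exact absurd (hF h hy.1) hxF
    · exact hD h hx
  · have : x ∈ {z | z ∈ D ∧ c z = c x} := ⟨hx, rfl⟩
    rw [← he] at this
    exact hxF this.1

/-- Only colors equal or adjacent to `c v` contribute. Elements of such colors are comparable with
`v`, and those in the filter `S` must lie above it. -/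
theorem gamePairing_colorCount_inter_Ioi [Finite P] [Fintype I] (hP : IsDComplete P)
    (hc : IsDCompleteColoring c)
    (lam : I → ℤ) {S : Set P} (hS : IsUpperSet S) {v : P} (hv : v ∉ S) :
    gamePairing (dynkinDiagram c) lam (colorCount c S) (c v) =
      gamePairing (dynkinDiagram c) lam (colorCount c (S ∩ Set.Ioi v)) (c v) := by
  have hlt : ∀ x ∈ S, (x ≤ v ∨ v ≤ x) → v < x := by
    rintro x hx (h | h)
    · exact absurd (hS h hx) hv
    · exact lt_of_le_of_ne h fun he => hv (he ▸ hx)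
  rw [gamePairing_colorCount, gamePairing_colorCount]
  congr 3
  · congr 2
    ext x
    simp only [Set.mem_ofPred_eq, Set.mem_inter_iff, Set.mem_Ioi]
    exact ⟨fun h => ⟨⟨h.1, hlt x h.1 (hc.le_or_le h.2)⟩, h.2⟩, fun h => ⟨h.1.1, h.2⟩⟩
  · ext x
    simp only [Set.mem_ofPred_eq, Set.mem_inter_iff, Set.mem_Ioi]
    exact ⟨fun h => ⟨⟨h.1, hlt x h.1 (le_or_le_of_adj hP hc h.2.symm)⟩, h.2⟩,
      fun h => ⟨h.1.1, h.2⟩⟩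

/-- In passing from `u` down to `v`, the element `u` itself contributes −2, and each element of `S`
of adjacent color between them contributes 1. -/
theorem IsColorSuccessor.gamePairing_colorCount [Finite P] [Fintype I] (hP : IsDComplete P)
    (hc : IsDCompleteColoring c)
    (lam : I → ℤ) {S : Set P} (hS : IsUpperSet S) {v u : P} (h : IsColorSuccessor c v u)
    (hu : u ∈ S) :
    gamePairing (dynkinDiagram c) lam (colorCount c (S ∩ Set.Ioi v)) (c v) =
      gamePairing (dynkinDiagram c) lam (colorCount c (Set.Ioi u)) (c u) - 2 +
        ({z | z ∈ S ∧ v < z ∧ z < u ∧ (dynkinDiagram c).Adj (c v) (c z)}.ncard : ℤ) := by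
  have e1 : {x | x ∈ S ∩ Set.Ioi v ∧ c x = c v} =
      insert u {x | x ∈ Set.Ioi u ∧ c x = c v} := by
    ext x
    simp only [Set.mem_ofPred_eq, Set.mem_inter_iff, Set.mem_Ioi,
      Set.mem_insert_iff]
    constructor
    · rintro ⟨⟨h1, h2⟩, h3⟩
      rcases hc.le_or_le (h3.trans h.color_eq) with h4 | h4
      · rcases h4.eq_or_lt with h4 | h4
        · exact .inl h4
        · exact absurd h3 (h.color_ne x h2 h4)
      · rcases h4.eq_or_lt with h4 | h4
        · exact .inl h4.symm
        · exact .inr ⟨h4, h3⟩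
    · rintro (rfl | ⟨h1, h2⟩)
      · exact ⟨⟨hu, h.lt⟩, h.color_eq.symm⟩
      · exact ⟨⟨hS h1.le hu, h.lt.trans h1⟩, h2⟩
  have e2 : {x | x ∈ S ∩ Set.Ioi v ∧
        (dynkinDiagram c).Adj (c v) (c x)} =
      {x | x ∈ Set.Ioi u ∧ (dynkinDiagram c).Adj (c v) (c x)} ∪
      {z | z ∈ S ∧ v < z ∧ z < u ∧ (dynkinDiagram c).Adj (c v) (c z)} := by
    ext x
    simp only [Set.mem_ofPred_eq, Set.mem_inter_iff, Set.mem_Ioi,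
      Set.mem_union]
    constructor
    · rintro ⟨⟨h1, h2⟩, h3⟩
      have hadj := h3
      rw [h.color_eq] at hadj
      have hne : x ≠ u := fun he => hadj.ne (congrArg c he.symm)
      rcases le_or_le_of_adj hP hc hadj with h4 | h4
      · exact .inl ⟨lt_of_le_of_ne h4 hne.symm, h3⟩
      · exact .inr ⟨h1, h2, lt_of_le_of_ne h4 hne, h3⟩
    · rintro (⟨h1, h2⟩ | ⟨h1, h2, h3, h4⟩)
      · exact ⟨⟨hS h1.le hu, h.lt.trans h1⟩, h2⟩
      · exact ⟨⟨h1, h2⟩, h4⟩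
  rw [← h.color_eq, _root_.gamePairing_colorCount, _root_.gamePairing_colorCount, e1, e2,
    Set.ncard_insert_of_notMem (by simp), Set.ncard_union_eq]
  · push_cast; ring
  · rw [Set.disjoint_left]
    intro x hx hx'
    simp only [Set.mem_ofPred_eq, Set.mem_Ioi] at hx hx'
    exact hx'.2.2.1.not_gt hx.1

theorem topWeight_of_mem_topForest (hc : IsDCompleteColoring c) {v : P} (hv : v ∈ topForest P) :
    (IsMax v → topWeight c (c v) = 1) ∧ (¬ IsMax v → topWeight c (c v) = 0) := by
  refine ⟨fun h => if_pos ⟨v, h, rfl⟩, fun h => if_neg ?_⟩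
  rintro ⟨x, hx, hcx⟩
  have hxt : x ∈ topForest P := fun y hy z z' hz _ =>
    absurd (hy.trans hz.le) fun h' => hz.lt.not_ge ((hx h').trans hy)
  exact h (hc.bijOn_topForest.injOn hxt hv hcx ▸ hx)

theorem gamePairing_colorCount_of_mem_topForest [Finite P] [Fintype I] (hP : IsDComplete P)
    (hc : IsDCompleteColoring c)
    {v : P} (hv : v ∈ topForest P) (S : Set P) :
    gamePairing (dynkinDiagram c) (topWeight c) (colorCount c (S ∩ Set.Ioi v)) (c v) =
      topWeight c (c v) + ({x | x ∈ S ∧ v ⋖ x}.ncard : ℤ) := by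
  have e1 : {x | x ∈ S ∩ Set.Ioi v ∧ c x = c v} = ∅ := by
    rw [Set.eq_empty_iff_forall_notMem]
    rintro x ⟨⟨-, hx⟩, hcx⟩
    have hx' : v < x := hx
    exact hx'.ne' (hc.bijOn_topForest.injOn (isUpperSet_topForest hx'.le hv) hv hcx)
  have e2 : {x | x ∈ S ∩ Set.Ioi v ∧
      (dynkinDiagram c).Adj (c v) (c x)} = {x | x ∈ S ∧ v ⋖ x} := by
    ext x
    simp only [Set.mem_ofPred_eq, Set.mem_inter_iff, Set.mem_Ioi]
    constructor
    · rintro ⟨⟨h1, h2⟩, h3⟩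
      rw [dynkinDiagram_adj_iff hc hv (isUpperSet_topForest h2.le hv)] at h3
      exact ⟨h1, h3.resolve_right fun h => h.lt.not_gt h2⟩
    · rintro ⟨h1, h2⟩
      exact ⟨⟨h1, h2.lt⟩, dynkinDiagram_adj_of_covBy hP hc _ _ h2⟩
  rw [gamePairing_colorCount, e1, e2]
  simp

/-- In the top forest the 1 comes from the weight if `v` is maximal and from its unique cover
otherwise. Elsewhere it is 1 − 2 + 2 by induction. -/
theorem gamePairing_colorCount_Ioi [Finite P] [Fintype I] (hP : IsDComplete P)
    (hc : IsDCompleteColoring c) (v : P) :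
    gamePairing (dynkinDiagram c) (topWeight c) (colorCount c (Set.Ioi v)) (c v) = 1 := by
  induction v using WellFoundedGT.induction with
  | _ v ih =>
    by_cases hv : v ∈ topForest P
    · have h := gamePairing_colorCount_of_mem_topForest hP hc hv Set.univ
      rw [Set.univ_inter] at h
      rw [h]
      by_cases hmax : IsMax v
      · rw [(topWeight_of_mem_topForest hc hv).1 hmax,
          (Set.eq_empty_iff_forall_notMem (s := {x | x ∈ Set.univ ∧ v ⋖ x})).2]
        · simp
        · rintro x ⟨-, hx⟩
          exact hmax.not_lt hx.lt
      · rw [(topWeight_of_mem_topForest hc hv).2 hmax]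
        obtain ⟨z, hz⟩ := not_isMax_iff.1 hmax
        obtain ⟨y, hy, -⟩ := exists_covBy_le_of_lt hz
        have : {x | x ∈ Set.univ ∧ v ⋖ x} = {y} := by
          ext x
          simp only [Set.mem_ofPred_eq, Set.mem_univ,
            Set.mem_singleton_iff]
          exact ⟨fun h => hv v le_rfl _ _ h.2 hy, fun h => ⟨trivial, h ▸ hy⟩⟩
        rw [this]
        simp
    · obtain ⟨u, hu⟩ := exists_isColorSuccessor hP hc hv
      have h := hu.gamePairing_colorCount hP hc (topWeight c) isUpperSet_univ (Set.mem_univ u)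
      rw [Set.univ_inter] at h
      rw [h, ih u hu.lt]
      obtain ⟨a, b, hab, h1, h2, h3, h4, h5, h6, h7, -, -⟩ := hu.exists_adj
      have : {z | z ∈ Set.univ ∧ v < z ∧ z < u ∧
          (dynkinDiagram c).Adj (c v) (c z)} = {a, b} := by
        ext x
        simp only [Set.mem_ofPred_eq, Set.mem_univ,
          Set.mem_singleton_iff, Set.mem_insert_iff]
        constructor
        · rintro ⟨-, h8, h9, h10⟩
          exact h7 x h8 h9 h10.symm
        · rintro (rfl | rfl)
          exacts [⟨trivial, h1, h2, h5.symm⟩, ⟨trivial, h3, h4, h6.symm⟩]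
      rw [this, Set.ncard_pair hab]
      norm_num

theorem gamePairing_colorCount_of_Ioi_subset [Finite P] [Fintype I] (hP : IsDComplete P)
    (hc : IsDCompleteColoring c)
    {S : Set P} (hS : IsUpperSet S) {v : P} (hv : v ∉ S) (h : Set.Ioi v ⊆ S) :
    gamePairing (dynkinDiagram c) (topWeight c) (colorCount c S) (c v) = 1 := by
  rw [gamePairing_colorCount_inter_Ioi hP hc _ hS hv, Set.inter_eq_right.2 h,
    gamePairing_colorCount_Ioi hP hc]

theorem exists_covBy_notMem [Finite P] {S : Set P} (hS : IsUpperSet S) {v : P} (h : ¬ Set.Ioi v ⊆ S) :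
    ∃ y, v ⋖ y ∧ y ∉ S := by
  obtain ⟨z, hz, hzS⟩ := Set.not_subset.1 h
  obtain ⟨y, hy, hyz⟩ := exists_covBy_le_of_lt (Set.mem_Ioi.1 hz)
  exact ⟨y, hy, fun hyS => hzS (hS hyz hyS)⟩

/-- Outside the top forest, of the two elements of adjacent colors below the successor, `hstar` puts
one in `S`, while a cover of `v` missing from `S` is the other; the value is 1 − 2 + 1. -/
theorem gamePairing_colorCount_of_not_Ioi_subset [Finite P] [Fintype I] (hP : IsDComplete P)
    (hc : IsDCompleteColoring c) {S : Set P} (hS : IsUpperSet S) {v : P} (hv : v ∉ S)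
    (h : ¬ Set.Ioi v ⊆ S)
    (hstar : ∀ u, IsColorSuccessor c v u →
      ∃ z ∈ S, v < z ∧ z < u ∧ (dynkinDiagram c).Adj (c v) (c z)) :
    gamePairing (dynkinDiagram c) (topWeight c) (colorCount c S) (c v) = 0 := by
  rw [gamePairing_colorCount_inter_Ioi hP hc _ hS hv]
  obtain ⟨y, hy, hyS⟩ := exists_covBy_notMem hS h
  by_cases hvt : v ∈ topForest P
  · rw [gamePairing_colorCount_of_mem_topForest hP hc hvt,
      (topWeight_of_mem_topForest hc hvt).2 (not_isMax_iff.2 ⟨y, hy.lt⟩),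
      (Set.eq_empty_iff_forall_notMem (s := {x | x ∈ S ∧ v ⋖ x})).2]
    · simp
    · rintro x ⟨hx, hvx⟩
      exact hyS (hvt v le_rfl _ _ hvx hy ▸ hx)
  · obtain ⟨u, hu⟩ := exists_isColorSuccessor hP hc hvt
    obtain ⟨z, hz, hvz, hzu, hzadj⟩ := hstar u hu
    rw [hu.gamePairing_colorCount hP hc _ hS (hS hzu.le hz), gamePairing_colorCount_Ioi hP hc]
    have : {z | z ∈ S ∧ v < z ∧ z < u ∧
          (dynkinDiagram c).Adj (c v) (c z)} = {z} := by
      obtain ⟨a, b, -, -, -, -, -, -, -, h7, -, -⟩ := hu.exists_adj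
      have h8 := h7 z hvz hzu hzadj.symm
      have h9 := h7 y hy.lt (hu.lt_of_covBy y hy) (dynkinDiagram_adj_of_covBy hP hc _ _ hy).symm
      ext x
      simp only [Set.mem_singleton_iff]
      constructor
      · rintro ⟨hx, h10, h11, h12⟩
        have h13 := h7 x h10 h11 h12.symm
        have hxy : x ≠ y := fun he => hyS (he ▸ hx)
        have hzy : z ≠ y := fun he => hyS (he ▸ hz)
        rcases h8 with rfl | rfl <;> rcases h9 with rfl | rfl <;> rcases h13 with rfl | rfl <;>
          first | rfl | exact absurd rfl hxy | exact absurd rfl hzy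
      · rintro rfl
        exact ⟨hz, hvz, hzu, hzadj⟩
    rw [this]
    simp

end ColorCount

/-! ### Words of filters and minimality of length. -/

section DemazureWord

variable {P : Type*} [PartialOrder P] {I : Type*} {c : P → I}

theorem not_ge_notMem_of_pairwise_cons {v : P} {L : List P}
    (h : (v :: L).Pairwise fun a b => ¬ b ≤ a) : v ∉ L ∧ ∀ x ∈ L, ¬ x ≤ v :=
  ⟨fun hv => (List.pairwise_cons.1 h).1 v hv le_rfl, (List.pairwise_cons.1 h).1⟩

theorem isUpperSet_of_cons {v : P} {L : List P} (h : (v :: L).Pairwise fun a b => ¬ b ≤ a)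
    (hU : IsUpperSet {x | x ∈ v :: L}) : IsUpperSet {x | x ∈ L} ∧ Set.Ioi v ⊆ {x | x ∈ L} := by
  obtain ⟨-, h2⟩ := not_ge_notMem_of_pairwise_cons h
  refine ⟨fun a b hab ha => ?_, fun y hy => ?_⟩
  · rcases List.mem_cons.1 (hU hab (List.mem_cons_of_mem v ha)) with rfl | hb
    · exact absurd hab (h2 a ha)
    · exact hb
  · rcases List.mem_cons.1 (hU (Set.mem_Ioi.1 hy).le List.mem_cons_self) with rfl | hb
    · exact absurd hy (lt_irrefl _)
    · exact hb

theorem isUpperSet_cons {v : P} {L : List P} (hU : IsUpperSet {x | x ∈ L})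
    (h : Set.Ioi v ⊆ {x | x ∈ L}) : IsUpperSet {x | x ∈ v :: L} := by
  intro a b hab ha
  rcases List.mem_cons.1 ha with rfl | ha
  · rcases hab.eq_or_lt with rfl | hlt
    · exact List.mem_cons_self
    · exact List.mem_cons_of_mem _ (h hlt)
  · exact List.mem_cons_of_mem _ (hU hab ha)

theorem setOf_mem_cons {P : Type*} (v : P) (L : List P) : {x | x ∈ v :: L} = insert v {x | x ∈ L} := by
  ext x; simp

variable [Finite P] [Fintype I] {W : Type*} [Group W]
  (cs : CoxeterSystem (simplyLacedCoxeterMatrix (dynkinDiagram c)) W)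

theorem gameMove_colorCount (hP : IsDComplete P) (hc : IsDCompleteColoring c) {v : P}
    {L : List P} (h : (v :: L).Pairwise fun a b => ¬ b ≤ a) (hU : IsUpperSet {x | x ∈ v :: L}) :
    gameMove (dynkinDiagram c) (topWeight c) (c v) (colorCount c {x | x ∈ L}) =
      colorCount c {x | x ∈ v :: L} := by
  classical
  obtain ⟨h1, h2⟩ := isUpperSet_of_cons h hU
  have hv : v ∉ {x | x ∈ L} := (not_ge_notMem_of_pairwise_cons h).1
  rw [gameMove, gamePairing_colorCount_of_Ioi_subset hP hc h1 hv h2, setOf_mem_cons,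
    colorCount_insert hv]

theorem gamePosition_wordProd (hP : IsDComplete P) (hc : IsDCompleteColoring c) {L : List P}
    (h : L.Pairwise fun a b => ¬ b ≤ a) (hU : IsUpperSet {x | x ∈ L}) :
    gamePosition (topWeight c) cs (cs.wordProd (L.map c)) = colorCount c {x | x ∈ L} := by
  induction L with
  | nil =>
    rw [List.map_nil, cs.wordProd_nil, gamePosition_one]
    simpa using colorCount_empty.symm
  | cons v L ih =>
    rw [List.map_cons, cs.wordProd_cons, gamePosition_simple_mul,
      ih h.of_cons (isUpperSet_of_cons h hU).1, gameMove_colorCount hP hc h hU]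

/-- The pairing of the reached weight at `c v` is −1, which forces `c v` to be a left descent of any
such `w`; removing it leads to the shorter list. -/
theorem length_le_of_gamePosition_eq (hP : IsDComplete P) (hc : IsDCompleteColoring c)
    {L : List P} (h : L.Pairwise fun a b => ¬ b ≤ a) (hU : IsUpperSet {x | x ∈ L}) (w : W)
    (hw : gamePosition (topWeight c) cs w = colorCount c {x | x ∈ L}) :
    L.length ≤ cs.length w := by
  induction L generalizing w with
  | nil => simp
  | cons v L ih =>
    obtain ⟨h1, h2⟩ := isUpperSet_of_cons h hU
    have hm := gameMove_colorCount hP hc h hU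
    rw [← hw] at hm
    have hpos : gamePosition (topWeight c) cs (cs.simple (c v) * w) =
        colorCount c {x | x ∈ L} := by
      rw [gamePosition_simple_mul, ← hm, gameMove_involutive]
    have hdesc : cs.IsLeftDescent w (c v) := by
      by_contra hcon
      have h3 := le_gamePairing_of_not_isLeftDescent cs le_rfl
        (topWeight_nonneg (c := c)) w (c v) hcon
      rw [← hm, gamePairing_gameMove_self, gamePairing_colorCount_of_Ioi_subset hP hc h1
        (not_ge_notMem_of_pairwise_cons h).1 h2] at h3
      norm_num at h3
    have h4 := ih h.of_cons h1 _ hpos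
    have h5 := cs.isLeftDescent_iff.1 hdesc
    rw [List.length_cons]
    omega

theorem length_wordProd_of_isUpperSet (hP : IsDComplete P) (hc : IsDCompleteColoring c)
    {L : List P} (h : L.Pairwise fun a b => ¬ b ≤ a) (hU : IsUpperSet {x | x ∈ L}) :
    cs.length (cs.wordProd (L.map c)) = L.length :=
  le_antisymm ((cs.length_wordProd_le _).trans (by simp))
    (length_le_of_gamePosition_eq cs hP hc h hU _ (gamePosition_wordProd cs hP hc h hU))

theorem demazureWordProd_of_isUpperSet (hP : IsDComplete P) (hc : IsDCompleteColoring c)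
    {L : List P} (h : L.Pairwise fun a b => ¬ b ≤ a) (hU : IsUpperSet {x | x ∈ L}) :
    demazureWordProd cs (L.map c) = cs.wordProd (L.map c) := by
  induction L with
  | nil => rfl
  | cons v L ih =>
    have h1 := (isUpperSet_of_cons h hU).1
    have h2 := length_wordProd_of_isUpperSet cs hP hc h hU
    rw [List.map_cons, cs.wordProd_cons, List.length_cons] at h2
    have h3 := ih h.of_cons h1
    rw [demazureWordProd] at h3
    rw [demazureWordProd, List.map_cons, List.foldr_cons, h3, cs.wordProd_cons,
      simpleDemazureMul_of_not_isLeftDescent]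
    rw [cs.not_isLeftDescent_iff, h2, length_wordProd_of_isUpperSet cs hP hc h.of_cons h1]

/-- `w` does not have minimal length among the elements that reach the same position, that is,
in its coset modulo the stabilizer of the weight. -/
def IsExcessive {I W : Type*} [Fintype I] [Group W] {G : SimpleGraph I} (lam : I → ℤ)
    (cs : CoxeterSystem (simplyLacedCoxeterMatrix G) W) (w : W) : Prop :=
  ∃ w', gamePosition lam cs w' = gamePosition lam cs w ∧ cs.length w' < cs.length w

/-- When s_i lengthens w, it lengthens the shorter competitor by at most one, so the gap in length
remains. -/
theorem IsExcessive.simpleDemazureMul {I W : Type*} [Fintype I] [Group W] {G : SimpleGraph I}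
    {lam : I → ℤ} {cs : CoxeterSystem (simplyLacedCoxeterMatrix G) W} {w : W}
    (h : IsExcessive lam cs w) (i : I) : IsExcessive lam cs (simpleDemazureMul cs i w) := by
  by_cases hd : cs.IsLeftDescent w i
  · rwa [simpleDemazureMul_of_isLeftDescent cs hd]
  · obtain ⟨w', h1, h2⟩ := h
    rw [simpleDemazureMul_of_not_isLeftDescent cs hd]
    refine ⟨cs.simple i * w', by rw [gamePosition_simple_mul, gamePosition_simple_mul, h1], ?_⟩
    have h3 := cs.not_isLeftDescent_iff.1 hd
    have h4 := cs.length_simple_mul w' i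
    omega

theorem isUpperSet_or_isExcessive (hP : IsDComplete P) (hc : IsDCompleteColoring c)
    {L : List P} (h : L.Pairwise fun a b => ¬ b ≤ a)
    (hstar : ∀ v ∈ L, ∀ u, IsColorSuccessor c v u →
      ∃ z ∈ L, v < z ∧ z < u ∧ (dynkinDiagram c).Adj (c v) (c z)) :
    IsUpperSet {x | x ∈ L} ∨ IsExcessive (topWeight c) cs (demazureWordProd cs (L.map c)) := by
  induction L with
  | nil => exact .inl fun a b _ ha => by simp at ha
  | cons v L ih =>
    obtain ⟨hv, hge⟩ := not_ge_notMem_of_pairwise_cons h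
    -- The witness lies strictly above `x`, whereas the head `v` is above no element of the tail, so
    -- the witness is in `L`.
    have hstar' : ∀ x, x = v ∨ x ∈ L → ∀ u, IsColorSuccessor c x u →
        ∃ z ∈ L, x < z ∧ z < u ∧ (dynkinDiagram c).Adj (c x) (c z) := by
      intro x hx u hu
      obtain ⟨z, hz, h1, h2, h3⟩ := hstar x (List.mem_cons.2 hx) u hu
      refine ⟨z, ?_, h1, h2, h3⟩
      rcases List.mem_cons.1 hz with rfl | hz
      · rcases hx with rfl | hx
        · exact absurd h1 (lt_irrefl _)
        · exact absurd h1.le (hge x hx)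
      · exact hz
    rcases ih h.of_cons fun x hx => hstar' x (.inr hx) with hU | hE
    · by_cases hsub : Set.Ioi v ⊆ {x | x ∈ L}
      · exact .inl (isUpperSet_cons hU hsub)
      · right
        have hzero := gamePairing_colorCount_of_not_Ioi_subset hP hc hU hv hsub
          (hstar' v (.inl rfl))
        have hpos := gamePosition_wordProd cs hP hc h.of_cons hU
        -- With pairing 0 the reflection fixes the weight, so the length bound also holds for its
        -- product with the word of `L`. Hence it is no descent, and it makes the element longer at
        -- the same weight.
        have hmove : gamePosition (topWeight c) cs
            (cs.simple (c v) * cs.wordProd (L.map c)) = colorCount c {x | x ∈ L} := by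
          classical
          rw [gamePosition_simple_mul, hpos, gameMove, hzero, Pi.single_zero, add_zero]
        have h1 := length_le_of_gamePosition_eq cs hP hc h.of_cons hU _ hmove
        have h2 := length_wordProd_of_isUpperSet cs hP hc h.of_cons hU
        have hd : ¬ cs.IsLeftDescent (cs.wordProd (L.map c)) (c v) := by
          rw [CoxeterSystem.IsLeftDescent]; omega
        have h3 := demazureWordProd_of_isUpperSet cs hP hc h.of_cons hU
        rw [demazureWordProd] at h3
        rw [demazureWordProd, List.map_cons, List.foldr_cons, h3,
          simpleDemazureMul_of_not_isLeftDescent cs hd]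
        refine ⟨cs.wordProd (L.map c), hpos.trans hmove.symm, ?_⟩
        have h4 := cs.not_isLeftDescent_iff.1 hd
        omega
    · exact .inr (hE.simpleDemazureMul (c v))

end DemazureWord

/-! ### Excitations and the Demazure product. -/

section Excitation

variable {P : Type*} [PartialOrder P] [Finite P] {I : Type*} {c : P → I}

open Classical in
/-- The elements of `D` in the order of the labelling `p`. -/
noncomputable def sortedList {N : ℕ} (p : Fin N ≃ P) (D : Set P) : List P :=
  ((List.finRange N).map p).filter (· ∈ D)

omit [PartialOrder P] [Finite P] in
theorem colorWord_eq_map_sortedList {N : ℕ} (p : Fin N ≃ P) (D : Set P) :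
    colorWord c p D = (sortedList p D).map c := by
  rw [colorWord, sortedList, List.filter_map, List.map_map]
  rfl

omit [PartialOrder P] [Finite P] in
theorem mem_sortedList {N : ℕ} (p : Fin N ≃ P) (D : Set P) (x : P) :
    x ∈ sortedList p D ↔ x ∈ D := by
  simp only [sortedList, List.mem_filter, List.mem_map, List.mem_finRange, true_and,
    decide_eq_true_eq, and_iff_right_iff_imp]
  exact fun _ => ⟨p.symm x, p.apply_symm_apply x⟩

omit [Finite P] in
theorem pairwise_map_finRange {N : ℕ} {p : Fin N ≃ P} (hp : IsLinearExtension p) :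
    ((List.finRange N).map p).Pairwise fun a b => ¬ b ≤ a := by
  rw [List.pairwise_map]
  refine (List.pairwise_lt_finRange N).imp fun {i j} hij hle => ?_
  rcases hle.eq_or_lt with h | h
  · exact hij.ne (p.injective h).symm
  · exact hij.not_gt (hp j i h)

omit [Finite P] in
theorem pairwise_sortedList {N : ℕ} {p : Fin N ≃ P} (hp : IsLinearExtension p) (D : Set P) :
    (sortedList p D).Pairwise fun a b => ¬ b ≤ a :=
  (pairwise_map_finRange hp).filter _

-- The letter of `u` commutes with the letters of `D` in `B` and can be moved to the place of `v`.
-- If `u` is kept, the letter then occurs twice in a row and is absorbed by idempotence.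
omit [PartialOrder P] [Finite P] in
open Classical in
theorem demazureWordProd_eq_of_insert [Finite I] {W : Type*} [Group W] {G : SimpleGraph I}
    (cs : CoxeterSystem (simplyLacedCoxeterMatrix G) W) {A B C : List P} {u v : P} {D D' : Set P}
    (huv : c v = c u) (hnd : (A ++ v :: B ++ u :: C).Nodup)
    (hu : u ∈ D) (hv : v ∉ D) (hB : ∀ x ∈ B, x ∈ D → ¬ G.Adj (c u) (c x))
    (hD' : D' = insert v (D \ {u}) ∨ D' = insert v D) :
    demazureWordProd cs (((A ++ v :: B ++ u :: C).filter (· ∈ D')).map c) =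
      demazureWordProd cs (((A ++ v :: B ++ u :: C).filter (· ∈ D)).map c) := by
  have huv' : u ≠ v := fun h => hv (h ▸ hu)
  have hiff : ∀ x, x ≠ u → x ≠ v → (x ∈ D' ↔ x ∈ D) := by
    intro x h1 h2
    rcases hD' with rfl | rfl <;> simp [h1, h2]
  have hvD' : v ∈ D' := by rcases hD' with rfl | rfl <;> simp
  have hfil : ∀ L : List P, u ∉ L → v ∉ L → L.filter (· ∈ D') = L.filter (· ∈ D) := by
    intro L h1 h2
    refine List.filter_congr fun x hx => ?_
    rw [decide_eq_decide]
    exact hiff x (fun h => h1 (h ▸ hx)) (fun h => h2 (h ▸ hx))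
  obtain ⟨huA, hvA, huB, hvB, huC, hvC⟩ :
      u ∉ A ∧ v ∉ A ∧ u ∉ B ∧ v ∉ B ∧ u ∉ C ∧ v ∉ C := by
    simp only [List.nodup_append, List.nodup_cons, List.mem_append, List.mem_cons] at hnd
    grind
  have hA := hfil A huA hvA
  have hB' := hfil B huB hvB
  have hC := hfil C huC hvC
  have hcomm : ∀ w, ((B.filter (· ∈ D)).map c).foldr (simpleDemazureMul cs)
      (simpleDemazureMul cs (c u) w) = simpleDemazureMul cs (c u)
        (((B.filter (· ∈ D)).map c).foldr (simpleDemazureMul cs) w) := by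
    refine foldr_simpleDemazureMul_comm cs _ fun j hj => ?_
    obtain ⟨x, hx, rfl⟩ := List.mem_map.1 hj
    rw [List.mem_filter, decide_eq_true_eq] at hx
    exact hB x hx.1 hx.2
  by_cases huD' : u ∈ D'
  · simp [demazureWordProd, hA, hB', hC, hvD', huD', hu, hv, huv, hcomm, simpleDemazureMul_self]
  · simp [demazureWordProd, hA, hB', hC, hvD', huD', hu, hv, huv, hcomm]

omit [Finite P] in
theorem exists_append_of_lt {L : List P} (hL : L.Pairwise fun a b => ¬ b ≤ a) {u v : P}
    (hu : u ∈ L) (hv : v ∈ L) (hvu : v < u) : ∃ A B C, L = A ++ v :: B ++ u :: C := by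
  obtain ⟨A, R, rfl⟩ := List.append_of_mem hv
  rw [List.pairwise_append] at hL
  rcases List.mem_append.1 hu with h | h
  · exact absurd hvu.le (hL.2.2 u h v List.mem_cons_self)
  · obtain ⟨B, C, rfl⟩ := List.append_of_mem ((List.mem_cons.1 h).resolve_left hvu.ne')
    exact ⟨A, B, C, by simp⟩

theorem weylDemazureElement_eq_of_kExcitation [Finite I] (hP : IsDComplete P)
    (hc : IsDCompleteColoring c) {N : ℕ} {p : Fin N ≃ P} (hp : IsLinearExtension p)
    {D D' : Set P} (h : KExcitation c D D') :
    weylDemazureElement c p D' = weylDemazureElement c p D := by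
  obtain ⟨u, v, ⟨hu, hv, hcol, hlt, -, hempty⟩, hD'⟩ := h
  have hmem : ∀ x, x ∈ (List.finRange N).map p := fun x =>
    List.mem_map.2 ⟨p.symm x, List.mem_finRange _, p.apply_symm_apply x⟩
  have hpw := pairwise_map_finRange hp
  obtain ⟨A, B, C, hL⟩ := exists_append_of_lt hpw (hmem u) (hmem v) hlt
  rw [hL] at hpw
  have hnd : (A ++ v :: B ++ u :: C).Nodup := hpw.imp fun hab he => hab he.ge
  rw [weylDemazureElement, weylDemazureElement, colorWord_eq_map_sortedList,
    colorWord_eq_map_sortedList, sortedList, sortedList, hL]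
  refine demazureWordProd_eq_of_insert _ hcol hnd hu hv (fun x hxB hxD hadj => ?_) hD'
  have hvx : ¬ x ≤ v := by
    rw [List.append_assoc, List.pairwise_append] at hpw
    exact (List.pairwise_cons.1 hpw.2.1).1 x (List.mem_append_left _ hxB)
  have hxu : ¬ u ≤ x := by
    rw [List.pairwise_append] at hpw
    exact hpw.2.2 x (List.mem_append_right _ (List.mem_cons_of_mem _ hxB)) u List.mem_cons_self
  have h1 : v ≤ x := (le_or_le_of_adj hP hc (hcol ▸ hadj)).resolve_right hvx
  have h2 : x ≤ u := (le_or_le_of_adj hP hc hadj).resolve_left hxu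
  have : x ∈ Set.Icc v u ∩ D ∩ adjColored c (c u) := ⟨⟨⟨h1, h2⟩, hxD⟩, hadj.symm⟩
  rw [hempty] at this
  exact this

omit [Finite P] in
/-- Moving `v` up to the next element `u` of its color undoes an elementary excitation. -/
theorem IsColorSuccessor.kExcitation {D : Set P} {u v : P} (h : IsColorSuccessor c v u)
    (hv : v ∈ D) (hempty : ∀ z ∈ D, v < z → z < u → ¬ (dynkinDiagram c).Adj (c v) (c z)) :
    KExcitation c (insert u (D \ {v})) D := by
  have huv : u ≠ v := h.lt.ne'
  refine ⟨u, v, ⟨by simp, by simp [huv.symm], h.color_eq, h.lt, h.isDInterval, ?_⟩, ?_⟩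
  · rw [Set.eq_empty_iff_forall_notMem]
    rintro x ⟨⟨⟨h1, h2⟩, h3⟩, h4⟩
    have hadj : (dynkinDiagram c).Adj (c v) (c x) := h.color_eq ▸ SimpleGraph.Adj.symm h4
    have hxv : x ≠ v := fun he => hadj.ne (congrArg c he.symm)
    have hxu : x ≠ u := fun he => hadj.ne (h.color_eq.trans (congrArg c he.symm))
    exact hempty x (h3.resolve_left hxu).1 (lt_of_le_of_ne h1 hxv.symm) (lt_of_le_of_ne h2 hxu)
      hadj
  -- The excitation is `K`-theoretical when `u` already belonged to `D`, and ordinary otherwise.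
  · by_cases hu : u ∈ D
    · right
      ext x
      by_cases hx : x = v <;> by_cases hx' : x = u <;> simp_all
    · left
      ext x
      by_cases hx : x = v <;> by_cases hx' : x = u <;> simp_all

omit [PartialOrder P] in
theorem sum_insert_diff_lt (f : P → ℕ) {D : Set P} {u v : P} (hv : v ∈ D) (hf : f u < f v) :
    ∑ᶠ x ∈ insert u (D \ {v}), f x < ∑ᶠ x ∈ D, f x := by
  have h1 : ∑ᶠ x ∈ D, f x = f v + ∑ᶠ x ∈ D \ {v}, f x := by
    rw [← finsum_mem_insert f (by simp) (Set.toFinite _), Set.insert_sdiff_singleton,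
      Set.insert_eq_of_mem hv]
  rw [h1]
  by_cases hu : u ∈ D \ {v}
  · rw [Set.insert_eq_of_mem hu]
    omega
  · rw [finsum_mem_insert f hu (Set.toFinite _)]
    omega

/-- Minimality of w_F excludes the excessive alternative, so `D` is a filter; both filters then
reach the same weight and have equal color counts. -/
theorem eq_of_no_kExcitation [Finite I] (hP : IsDComplete P) (hc : IsDCompleteColoring c)
    {N : ℕ} {p : Fin N ≃ P} (hp : IsLinearExtension p) {F D : Set P} (hF : IsUpperSet F)
    (hD : weylDemazureElement c p D = weylElement c p F)
    (hstar : ∀ v ∈ D, ∀ u, IsColorSuccessor c v u →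
      ∃ z ∈ D, v < z ∧ z < u ∧ (dynkinDiagram c).Adj (c v) (c z)) : D = F := by
  have := Fintype.ofFinite I
  have hset : ∀ S : Set P, {x | x ∈ sortedList p S} = S := fun S => by
    ext x; exact mem_sortedList p S x
  have hpF := pairwise_sortedList hp F
  have hpD := pairwise_sortedList hp D
  have hUF : IsUpperSet {x | x ∈ sortedList p F} := by rwa [hset]
  rw [weylDemazureElement, weylElement, colorWord_eq_map_sortedList,
    colorWord_eq_map_sortedList] at hD
  have hposF := gamePosition_wordProd (weylSystem c) hP hc hpF hUF
  rcases isUpperSet_or_isExcessive (weylSystem c) hP hc hpD (by simpa [mem_sortedList]) with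
    hU | ⟨w, h1, h2⟩
  · rw [demazureWordProd_of_isUpperSet _ hP hc hpD hU] at hD
    have hposD := gamePosition_wordProd (weylSystem c) hP hc hpD hU
    rw [hD, hposF, hset, hset] at hposD
    rw [hset] at hU
    exact (subset_of_colorCount_eq hc hU hF hposD.symm).antisymm
      (subset_of_colorCount_eq hc hF hU hposD)
  · rw [hD] at h1 h2
    have h3 := length_le_of_gamePosition_eq _ hP hc hpF hUF w (h1.trans hposF)
    rw [length_wordProd_of_isUpperSet _ hP hc hpF hUF] at h2
    omega

theorem isKExcitedDiagram_of_eq [Finite I] (hP : IsDComplete P) (hc : IsDCompleteColoring c)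
    {N : ℕ} {p : Fin N ≃ P} (hp : IsLinearExtension p) {F : Set P} (hF : IsUpperSet F) (D : Set P)
    (hD : weylDemazureElement c p D = weylElement c p F) : IsKExcitedDiagram c F D := by
  -- Moving `v` up to `u` raises its index and so lowers this sum, also when `u` was already in `D`
  -- and `v` merely disappears.
  induction hn : ∑ᶠ x ∈ D, (N - p.symm x : ℕ) using Nat.strong_induction_on generalizing D with
  | _ n ih =>
    by_cases hex : ∃ v ∈ D, ∃ u, IsColorSuccessor c v u ∧
        ∀ z ∈ D, v < z → z < u → ¬ (dynkinDiagram c).Adj (c v) (c z)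
    · obtain ⟨v, hv, u, hu, hempty⟩ := hex
      have hk := hu.kExcitation hv hempty
      have hlt : (N - p.symm u : ℕ) < N - p.symm v := by
        have h1 : p.symm v < p.symm u := hp _ _ (by simpa using hu.lt)
        have h2 := (p.symm u).2
        have h3 : (p.symm v : ℕ) < p.symm u := h1
        omega
      refine .tail (ih _ (hn ▸ sum_insert_diff_lt (fun x => (N - p.symm x : ℕ)) hv hlt) _ ?_ rfl) hk
      rw [← hD]
      exact (weylDemazureElement_eq_of_kExcitation hP hc hp hk).symm
    · push Not at hex
      rw [eq_of_no_kExcitation hP hc hp hF hD hex]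
      exact .refl

end Excitation

/-! ### The proposition. -/

theorem mainTheorem2 {P : Type*} [PartialOrder P] [Finite P]
    (hP : IsDComplete P) (hconn : (SimpleGraph.hasse P).Connected)
    {I : Type*} (c : P → I) (hc : IsDCompleteColoring c)
    {N : ℕ} (p : Fin N ≃ P) (hp : IsLinearExtension p)
    (F : Set P) (hF : IsUpperSet F) (D : Set P) :
    IsKExcitedDiagram c F D ↔ weylDemazureElement c p D = weylElement c p F := by
  have hI : Finite I := by
    refine Finite.of_surjective c fun i => ?_
    obtain ⟨x, -, hx⟩ := exists_topForest_color hc i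
    exact ⟨x, hx⟩
  refine ⟨fun h => ?_, isKExcitedDiagram_of_eq hP hc hp hF D⟩
  induction h with
  | refl =>
    have := Fintype.ofFinite I
    rw [weylDemazureElement, weylElement, colorWord_eq_map_sortedList]
    refine demazureWordProd_of_isUpperSet _ hP hc (pairwise_sortedList hp F) ?_
    have : {x | x ∈ sortedList p F} = F := by ext x; exact mem_sortedList p F x
    rwa [this]
  | tail _ hstep ih => rw [weylDemazureElement_eq_of_kExcitation hP hc hp hstep, ih]
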